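/- Let $\mathbb F$ be a skew field (division ring) and let $G$ be a group of type $\mathsf{FP}_{n+1}(\mathbb F)$, i.e. the trivial $\mathbb FG$-module $\mathbb F$ has a projective resolution $P_\bullet\to\mathbb F$ with $P_i$ finitely generated for all $i\leqslant n+1$. Suppose that $G$ is locally indicable, that a Hughes-free division ring $\mathcal D_{\mathbb FG}$ of the group ring $\mathbb FG$ exists, and that it is the universal division ring of fractions of $\mathbb FG$. If $H\leqslant G$ is any subgroup of finite index, then $b_m(H;\mathbb F)<\infty$ and \[ b_m^{\mathcal D_{\mathbb FG}}(G)\;\leqslant\;\frac{b_m(H;\mathbb F)}{[G:H]}\qquad\text{for all } m\leqslant n. \] In particular, if $G$ is residually finite and $(G_i)_{i\in\mathbb N}$ is a residual chain of $G$, that is, a chain $G=G_0\geqslant G_1\geqslant\cdots$ of finite-index normal subgroups of $G$ with $\bigcap_i G_i=\{1\}$, then \[ b_m^{\mathcal D_{\mathbb FG}}(G)\;\leqslant\; b_m^{(2)}(G,(G_i);\mathbb F):=\limsup_{i\to\infty}\frac{b_m(G_i;\mathbb F)}{[G:G_i]}\qquad\text{for all } m\leqslant n. \] Here $b_m(H;\mathbb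 F)=\dim_{\mathbb F}H_m(H;\mathbb F)$ and $b_m^{\mathcal D_{\mathbb FG}}(G)=\dim_{\mathcal D_{\mathbb FG}}H_m(\mathcal D_{\mathbb FG}\otimes_{\mathbb FG}P_\bullet)$ for a projective resolution $P_\bullet\to\mathbb F$ of the trivial $\mathbb FG$-module. A group is locally indicable if every nontrivial finitely generated subgroup maps onto $\mathbb Z$. A ring homomorphism $\iota\colon\mathbb FG\to\mathcal D$ to a division ring is Hughes-free if its image generates $\mathcal D$ as a division ring and, for every nontrivial finitely generated subgroup $K\leqslant G$, every normal subgroup $N$ of $K$ with $K/N\cong\mathbb Z$, and all $k_1,\dots,k_r\in K$ in pairwise distinct cosets of $N$, the elements $\iota(k_1),\dots,\iota(k_r)$ are left linearly independent over the division subring of $\mathcal D$ generated by $\iota(\mathbb FN)$. A ring homomorphism $\iota\colon R\to\mathcal D$ to a division ring is a universal division ring of fractions of $R$ if it is injective, its image generates $\mathcal D$ as a division ring, and $\operatorname{rk}_{\mathcal D}(\iota_*A)\geqslant\operatorname{rk}_{\mathcal E}(\psi_*A)$ for every ring homomorphism $\psi\colon R\to\mathcal E$ to a division ring and every matrix $A$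 over $R$. -/

import Mathlib

open CategoryTheory TensorProduct
open scoped ENNReal

universe u v w

/-! ### Base change along a homomorphism of (not necessarily commutative) rings -/

section BaseChange

variable {R : Type u} [Ring R] {S : Type v} [Ring S] (φ : R →+* S)

/-- The relations `(s · φ r) ⊗ m = s ⊗ (r • m)` in `S ⊗[ℤ] M`, which cut out `S ⊗[R] M`. -/
def baseChangeRel (M : Type w) [AddCommGroup M] [Module R M] : Submodule S (S ⊗[ℤ] M) :=
  Submodule.span S
    {x | ∃ (s : S) (r : R) (m : M), x = (s * φ r) ⊗ₜ[ℤ] m - s ⊗ₜ[ℤ] (r • m)}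

/-- The left `S`-module `S ⊗[R] M`, where `S` is a right `R`-module through `φ` and `M` is a
left `R`-module. -/
abbrev BaseChange (M : Type w) [AddCommGroup M] [Module R M] : Type (max v w) :=
  (S ⊗[ℤ] M) ⧸ baseChangeRel φ M

/-- The `S`-linear map `S ⊗[ℤ] M → S ⊗[ℤ] N` induced by an `R`-linear map `M → N`. -/
noncomputable def tensorMap {M N : Type w} [AddCommGroup M] [Module R M] [AddCommGroup N]
    [Module R N] (f : M →ₗ[R] N) : S ⊗[ℤ] M →ₗ[S] S ⊗[ℤ] N :=
  TensorProduct.AlgebraTensorModule.map (LinearMap.id : S →ₗ[S] S)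
    (f.toAddMonoidHom.toIntLinearMap)

theorem baseChangeRel_le_comap {M N : Type w} [AddCommGroup M] [Module R M] [AddCommGroup N]
    [Module R N] (f : M →ₗ[R] N) :
    baseChangeRel φ M ≤ (baseChangeRel φ N).comap (tensorMap (S := S) f) := by
  refine Submodule.span_le.2 ?_
  rintro _ ⟨s, r, m, rfl⟩
  exact Submodule.subset_span ⟨s, r, f m, by simp [tensorMap]⟩

/-- The `S`-linear map `S ⊗[R] M → S ⊗[R] N` induced by an `R`-linear map `M → N`. -/
noncomputable def baseChangeMap {M N : Type w} [AddCommGroup M] [Module R M] [AddCommGroup N]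
    [Module R N] (f : M →ₗ[R] N) : BaseChange φ M →ₗ[S] BaseChange φ N :=
  (baseChangeRel φ M).mapQ (baseChangeRel φ N) (tensorMap f) (baseChangeRel_le_comap φ f)

theorem baseChange_hom_ext {M : Type w} [AddCommGroup M] [Module R M] {P : Type*}
    [AddCommGroup P] [Module S P] {f g : BaseChange φ M →ₗ[S] P}
    (h : ∀ (s : S) (m : M), f (Submodule.Quotient.mk (s ⊗ₜ[ℤ] m)) =
      g (Submodule.Quotient.mk (s ⊗ₜ[ℤ] m))) : f = g := by
  refine Submodule.linearMap_qext _ (LinearMap.ext fun x => ?_)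
  induction x with
  | zero => simp
  | tmul s m => exact h s m
  | add x y hx hy => rw [map_add, map_add, hx, hy]

@[simp]
theorem baseChangeMap_mk {M N : Type w} [AddCommGroup M] [Module R M] [AddCommGroup N]
    [Module R N] (f : M →ₗ[R] N) (s : S) (m : M) :
    baseChangeMap φ f (Submodule.Quotient.mk (s ⊗ₜ[ℤ] m)) =
      Submodule.Quotient.mk (s ⊗ₜ[ℤ] f m) := rfl

end BaseChange

section Tor

variable {R S : Type u} [Ring R] [Ring S] (φ : R →+* S)

/-- The functor `M ↦ S ⊗[R] M` from left `R`-modules to left `S`-modules. -/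
noncomputable def baseChangeFunctor : ModuleCat.{u} R ⥤ ModuleCat.{u} S where
  obj M := ModuleCat.of S (BaseChange φ M)
  map f := ModuleCat.ofHom (baseChangeMap φ f.hom)
  map_id M := by
    refine ModuleCat.hom_ext (baseChange_hom_ext φ fun s m => ?_)
    simp
  map_comp f g := by
    refine ModuleCat.hom_ext (baseChange_hom_ext φ fun s m => ?_)
    simp

instance baseChangeFunctor_additive : (baseChangeFunctor φ).Additive where
  map_add {M N f g} := by
    refine ModuleCat.hom_ext (baseChange_hom_ext φ fun s m => ?_)
    change (Submodule.Quotient.mk (s ⊗ₜ[ℤ] (f.hom m + g.hom m)) : BaseChange φ N) =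
      Submodule.Quotient.mk (s ⊗ₜ[ℤ] f.hom m) + Submodule.Quotient.mk (s ⊗ₜ[ℤ] g.hom m)
    rw [← Submodule.Quotient.mk_add, ← tmul_add]

end Tor

/-! ### Group rings: augmentation, finiteness properties, Betti numbers -/

section GroupRing

variable (F G : Type u) [DivisionRing F] [Group G]

/-- The augmentation `F[G] → F`, `∑ λ_g g ↦ ∑ λ_g`. -/
noncomputable def augmentation : MonoidAlgebra F G →+* F :=
  MonoidAlgebra.liftNCRingHom (RingHom.id F) (1 : G →* F) (fun _ _ => Commute.one_right _)

/-- The trivial left `F[G]`-module `F`. -/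
noncomputable def trivialModule : ModuleCat.{u} (MonoidAlgebra F G) :=
  (ModuleCat.restrictScalars (augmentation F G)).obj (ModuleCat.of F F)

/-- `G` is of type `FP_n(F)`: the trivial `F[G]`-module `F` has a projective resolution whose
terms in degrees `≤ n` are finitely generated. -/
def IsTypeFP (n : ℕ) : Prop :=
  ∃ P : ProjectiveResolution (trivialModule F G),
    ∀ i ≤ n, Module.Finite (MonoidAlgebra F G) (P.complex.X i)

variable {F G} {D : Type u} [DivisionRing D]

/-- The homology `H_m(G; D) = H_m(D ⊗_{F[G]} P_•) = Tor_m^{F[G]}(D, F)` of `G` with coefficients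
in `D`, a right `F[G]`-module through `φ`; here `P_•` is a projective resolution of the trivial
`F[G]`-module `F`. It is a left vector space over `D`. -/
noncomputable def groupHomologyOver (φ : MonoidAlgebra F G →+* D) (m : ℕ) : ModuleCat.{u} D :=
  ((baseChangeFunctor φ).leftDerived m).obj (trivialModule F G)

/-- The Betti number `dim_D H_m(G; D)`, an element of `{0, 1, 2, …} ∪ {∞}`. -/
noncomputable def bettiOver (φ : MonoidAlgebra F G →+* D) (m : ℕ) : ℕ∞ :=
  Cardinal.toENat (Module.rank D (groupHomologyOver φ m))

variable (F G) in
/-- The ordinary Betti number `b_m(G; F) = dim_F H_m(G; F)`. -/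
noncomputable def betti (m : ℕ) : ℕ∞ :=
  bettiOver (augmentation F G) m

end GroupRing

/-! ### Residual chains and homology gradients -/

section Gradient

variable {G : Type u} [Group G]

/-- A residual chain: a descending sequence `G = G_0 ≥ G_1 ≥ …` of finite-index normal subgroups
with trivial intersection. -/
structure IsResidualChain (K : ℕ → Subgroup G) : Prop where
  zero : K 0 = ⊤
  antitone : Antitone K
  normal : ∀ i, (K i).Normal
  finiteIndex : ∀ i, (K i).FiniteIndex
  iInf_eq_bot : ⨅ i, K i = ⊥

/-- The `m`-th `F`-homology gradient `limsup_i b_m(G_i; F) / [G : G_i]`. -/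
noncomputable def homologyGradient (F : Type u) [DivisionRing F] (K : ℕ → Subgroup G) (m : ℕ) :
    ℝ≥0∞ :=
  Filter.limsup (fun i => (betti F (K i) m : ℝ≥0∞) / ((K i).index : ℝ≥0∞)) Filter.atTop

end Gradient

/-! ### Hughes-free and universal division rings of fractions -/

section DivisionRings

/-- The rank of a matrix over a division ring: the dimension of the left vector space that is
spanned by its rows (equivalently, of the right vector space spanned by its columns). -/
noncomputable def skewRank {E : Type v} [DivisionRing E] {m n : ℕ}
    (A : Matrix (Fin m) (Fin n) E) : ℕ :=
  Module.finrank E (Submodule.span E (Set.range A.row))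

/-- `ι : R → D` makes the division ring `D` a universal division ring of fractions of `R`: it is
an embedding, its image generates `D` as a division ring, and for every matrix over `R` the rank
over `D` is at least the rank over any other division ring `E` to which `R` maps. (Ranks do not
change when `E` is replaced by the division subring generated by the image of `R`, so it suffices
that `E` ranges over the universe of `R`.) -/
structure IsUniversalDivisionRing {R : Type u} [Ring R] {D : Type v} [DivisionRing D]
    (ι : R →+* D) : Prop where
  injective : Function.Injective ι
  epic : Subfield.closure (Set.range ι) = ⊤
  rank_le : ∀ (E : Type u) [DivisionRing E] (ψ : R →+* E) (m n : ℕ)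
    (A : Matrix (Fin m) (Fin n) R), skewRank (A.map ψ) ≤ skewRank (A.map ι)

/-- A group is locally indicable if each of its nontrivial finitely generated subgroups maps onto
the infinite cyclic group. -/
def IsLocallyIndicable (G : Type u) [Group G] : Prop :=
  ∀ H : Subgroup G, H.FG → H ≠ ⊥ → ∃ f : H →* Multiplicative ℤ, Function.Surjective f

variable {F G D : Type u} [DivisionRing F] [Group G] [DivisionRing D]

/-- For a subgroup `N` of `G`, the division subring `D_N` of `D` generated by the image of `F[N]`,
that is, by the images of the elements `λ g` with `λ ∈ F` and `g ∈ N`. -/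
def divisionClosure (ι : MonoidAlgebra F G →+* D) (N : Subgroup G) : Subfield D :=
  Subfield.closure {x | ∃ (c : F) (g : G), g ∈ N ∧ x = ι (MonoidAlgebra.single g c)}

/-- `ι : F[G] → D` makes `D` a Hughes-free division ring of `F[G]`: the image of `ι` generates `D`
as a division ring and, whenever `H` is a finitely generated subgroup of `G` and `N` is a normal
subgroup of `H` with `H / N` infinite cyclic (that is, `N` is the kernel of a homomorphism `f` of
`H` onto the infinite cyclic group), elements of `H` in pairwise different cosets of `N` are left
linearly independent over `D_N`. -/
structure IsHughesFree (ι : MonoidAlgebra F G →+* D) : Prop where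
  epic : Subfield.closure (Set.range ι) = ⊤
  linearIndependent : ∀ H : Subgroup G, H.FG →
    ∀ f : H →* Multiplicative ℤ, Function.Surjective f →
    ∀ (k : ℕ) (h : Fin k → H), Function.Injective (fun i => f (h i)) →
      LinearIndependent (divisionClosure ι (f.ker.map H.subtype))
        (fun i => ι (MonoidAlgebra.single (h i : G) (1 : F)))

end DivisionRings

/-! Put k = [G:H] and κ = G/H. Both Betti numbers are computed from one resolution P over F[G]: that
of H with the functor T' = F ⊗_{F[H]} –, the other with T = D ⊗_{F[G]} –. On free modules T' turns a
matrix A over F[G] into its image under the permutation representation F[G] → M_κ(F). The core is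
that this image has rank at most k · rk_D(A) (`rowRank_permHom_augmentation_le`). Applied to an
idempotent and its complement, the bound forces dim T'(M) = k · dim T(M) for finitely generated
projective M. As the homology has dimension dim X₂ − rk f − rk g, smaller ranks mean larger
homology, which is the Betti inequality.

The rank bound uses universality twice. The permutation representation is `permHom`, sending g to g
times its permutation matrix in M_κ(F[G]), followed by the augmentation; universality against F
replaces the augmentation by ι. It remains to bound the rank over D of δ(A), where δ = ι ∘ `permHom`
takes values in M_κ(D). If δ lands in a division subring T₀ of M_κ(D), then δ(A) factors through r =
rk_{T₀} δ(A) coordinates over T₀, hence through kr coordinates over D, and universality against T₀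
gives r ≤ rk_D(A).

The existence of T₀ (`exists_division_subring`) uses local indicability and Hughes-freeness. If a
finitely generated L maps onto ℤ, Hughes-freeness yields a skew Laurent polynomial ring whose Ore
division ring A maps to D and to the Laurent series over D. Matrices over A provide Laurent
expansions, with coefficients in M_κ(D), of the elements rational over F[L]. An element is `Good` if
passing repeatedly to coefficients, always along gradings that are nontrivial on its supporting
subgroup, terminates. By induction a nonzero good element has an invertible leading coefficient,
hence is a unit, and its inverse is good. The good elements, up to trivial units, form T₀. -/

/-! ### Expansions along gradings of finitely generated subgroups -/

section Expansions

variable {F G R : Type u} [DivisionRing F] [Group G] [Ring R]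

/-- `φ` restricts to a homomorphism of the finitely generated group `L` onto `ℤ`. -/
structure IsGrading (L : Subgroup G) (φ : G → ℤ) : Prop where
  fg : L.FG
  map_mul : ∀ a ∈ L, ∀ b ∈ L, φ (a * b) = φ a + φ b
  surj : ∃ t ∈ L, φ t = 1

theorem IsGrading.map_one {L : Subgroup G} {φ : G → ℤ} (h : IsGrading L φ) : φ 1 = 0 := by
  have := h.map_mul 1 L.one_mem 1 L.one_mem
  rw [mul_one] at this
  omega

theorem IsGrading.map_inv {L : Subgroup G} {φ : G → ℤ} (h : IsGrading L φ) {a : G}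
    (ha : a ∈ L) : φ a⁻¹ = - φ a := by
  have := h.map_mul a ha a⁻¹ (L.inv_mem ha)
  rw [mul_inv_cancel, h.map_one] at this
  omega

/-- The kernel of a grading. -/
def gradingKer {L : Subgroup G} {φ : G → ℤ} (h : IsGrading L φ) : Subgroup G where
  carrier := {s | s ∈ L ∧ φ s = 0}
  mul_mem' ha hb := ⟨L.mul_mem ha.1 hb.1, by
    rw [h.map_mul _ ha.1 _ hb.1, ha.2, hb.2, add_zero]⟩
  one_mem' := ⟨L.one_mem, h.map_one⟩
  inv_mem' ha := ⟨L.inv_mem ha.1, by rw [h.map_inv ha.1, ha.2, neg_zero]⟩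

theorem exists_isGrading (hG : IsLocallyIndicable G) {S : Subgroup G} (hS : S.FG)
    (hS0 : S ≠ ⊥) : ∃ φ : G → ℤ, IsGrading S φ := by
  classical
  obtain ⟨f, hf⟩ := hG S hS hS0
  refine ⟨fun x => if h : x ∈ S then (f ⟨x, h⟩).toAdd else 0, hS, fun a ha b hb => ?_, ?_⟩
  · rw [dif_pos ha, dif_pos hb, dif_pos (S.mul_mem ha hb), ← toAdd_mul, ← _root_.map_mul]
    rfl
  · obtain ⟨⟨t, ht⟩, h⟩ := hf (Multiplicative.ofAdd 1)
    exact ⟨t, ht, by rw [dif_pos ht, h]; rfl⟩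

/-- The conjugate `g L g⁻¹`. -/
def conjSubgroup (g : G) (L : Subgroup G) : Subgroup G :=
  L.map (MulAut.conj g).toMonoidHom

theorem mem_conjSubgroup {g x : G} {L : Subgroup G} :
    x ∈ conjSubgroup g L ↔ g⁻¹ * x * g ∈ L := by
  constructor
  · rintro ⟨y, hy, rfl⟩
    simpa [mul_assoc] using hy
  · intro h
    exact ⟨_, h, by simp [mul_assoc]⟩

theorem fg_conjSubgroup {L : Subgroup G} (h : L.FG) (g : G) : (conjSubgroup g L).FG := by
  obtain ⟨T, rfl, hT⟩ := (Subgroup.fg_iff L).1 h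
  refine (Subgroup.fg_iff _).2 ⟨(MulAut.conj g).toMonoidHom '' T, ?_, hT.image _⟩
  exact (MonoidHom.map_closure _ _).symm

theorem IsGrading.conj {L : Subgroup G} {φ : G → ℤ} (h : IsGrading L φ) (g : G) :
    IsGrading (conjSubgroup g L) (fun x => φ (g⁻¹ * x * g)) where
  fg := fg_conjSubgroup h.fg g
  map_mul a ha b hb := by
    rw [← h.map_mul _ (mem_conjSubgroup.1 ha) _ (mem_conjSubgroup.1 hb)]
    congr 1
    group
  surj := by
    obtain ⟨t, ht, h1⟩ := h.surj
    refine ⟨g * t * g⁻¹, mem_conjSubgroup.2 ?_, ?_⟩ <;> simpa [mul_assoc]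

variable (δ : MonoidAlgebra F G →+* R)

/-- The image in `Rˣ` of the trivial unit `c · g` of the group ring. -/
noncomputable def monomialUnit : Fˣ × G →* Rˣ :=
  (Units.map (δ : MonoidAlgebra F G →* R)).comp ((Units.map MonoidAlgebra.singleHom).comp
    (MulEquiv.prodUnits.symm.toMonoidHom.comp
      (MonoidHom.prodMap (MonoidHom.id Fˣ) toUnits.toMonoidHom)))

theorem monomialUnit_val (v : Fˣ × G) :
    (monomialUnit δ v : R) = δ (MonoidAlgebra.single v.2 (v.1 : F)) := rfl

theorem monomialUnit_inv_val (v : Fˣ × G) :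
    (((monomialUnit δ v)⁻¹ : Rˣ) : R) = δ (MonoidAlgebra.single v.2⁻¹ ((v.1⁻¹ : Fˣ) : F)) := by
  rw [← _root_.map_inv, monomialUnit_val]
  rfl

/-- `Expands δ L φ x y`: the element `x` of the rational closure of the image of `F[L]` has the
Laurent expansion `y` with respect to the grading `φ`. -/
inductive Expands (L : Subgroup G) (φ : G → ℤ) : R → HahnSeries ℤ R → Prop
  | mon (c : F) (g : G) (hg : g ∈ L) :
      Expands L φ (δ (MonoidAlgebra.single g c))
        (HahnSeries.single (φ g) (δ (MonoidAlgebra.single g c)))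
  | add {x x' : R} {y y' : HahnSeries ℤ R} :
      Expands L φ x y → Expands L φ x' y' → Expands L φ (x + x') (y + y')
  | mul {x x' : R} {y y' : HahnSeries ℤ R} :
      Expands L φ x y → Expands L φ x' y' → Expands L φ (x * x') (y * y')
  | inv {x x' : R} {y y' : HahnSeries ℤ R} : Expands L φ x y → x * x' = 1 → x' * x = 1 →
      y * y' = 1 → y' * y = 1 → Expands L φ x' y'

/-- The rational closure of the image of `F[S]`. -/
inductive InRat (S : Subgroup G) : R → Prop
  | mon (c : F) (g : G) (hg : g ∈ S) : InRat S (δ (MonoidAlgebra.single g c))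
  | add {x x' : R} : InRat S x → InRat S x' → InRat S (x + x')
  | mul {x x' : R} : InRat S x → InRat S x' → InRat S (x * x')
  | inv {x x' : R} : InRat S x → x * x' = 1 → x' * x = 1 → InRat S x'

/-- A ring `B`, contained both in `R` and in the ring of Laurent series over `R`, which carries
the expansions of the elements of the rational closure of the image of `F[L]`. -/
def HasExpansions (L : Subgroup G) (φ : G → ℤ) : Prop :=
  ∃ (B : Type u) (_ : Ring B) (p : B →+* R) (q : B →+* HahnSeries ℤ R),
    Function.Injective p ∧ Function.Injective q ∧ (∀ b : B, IsRightRegular b → IsUnit b) ∧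
    ∀ (c : F) (g : G), g ∈ L → ∃ b, p b = δ (MonoidAlgebra.single g c) ∧
      q b = HahnSeries.single (φ g) (δ (MonoidAlgebra.single g c))

variable {δ}

theorem isUnit_of_map_isUnit {B R : Type*} [Ring B] [Ring R] {p : B →+* R}
    (hp : Function.Injective p)
    (hB : ∀ b : B, IsRightRegular b → IsUnit b) {b : B} (h : IsUnit (p b)) : IsUnit b := by
  refine hB b fun c c' hc => hp (h.mul_right_cancel ?_)
  simpa using congrArg p hc

/-- An element and its expansion are the two images of one element of B. Inversion lifts because `p`
is injective and right regular elements of B are units. Uniqueness of expansions, and their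
existence for inverses, both follow. -/
theorem Expands.lift {L : Subgroup G} {φ : G → ℤ} {B : Type*} [Ring B] {p : B →+* R}
    {q : B →+* HahnSeries ℤ R} (hp : Function.Injective p)
    (hB : ∀ b : B, IsRightRegular b → IsUnit b)
    (hm : ∀ (c : F) (g : G), g ∈ L → ∃ b, p b = δ (MonoidAlgebra.single g c) ∧
      q b = HahnSeries.single (φ g) (δ (MonoidAlgebra.single g c)))
    {x : R} {y : HahnSeries ℤ R} (h : Expands δ L φ x y) : ∃ b, p b = x ∧ q b = y := by
  induction h with
  | mon c g hg => exact hm c g hg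
  | add _ _ h h' =>
    obtain ⟨b, rfl, rfl⟩ := h
    obtain ⟨b', rfl, rfl⟩ := h'
    exact ⟨b + b', map_add _ _ _, map_add _ _ _⟩
  | mul _ _ h h' =>
    obtain ⟨b, rfl, rfl⟩ := h
    obtain ⟨b', rfl, rfl⟩ := h'
    exact ⟨b * b', map_mul _ _ _, map_mul _ _ _⟩
  | inv _ h1 h2 h3 h4 h =>
    obtain ⟨b, rfl, rfl⟩ := h
    obtain ⟨b, rfl⟩ := isUnit_of_map_isUnit hp hB ⟨⟨_, _, h1, h2⟩, rfl⟩
    refine ⟨(b⁻¹ : Bˣ), ?_, ?_⟩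
    · refine (left_inv_eq_right_inv h2 ?_).symm
      rw [← map_mul, Units.mul_inv, map_one]
    · refine (left_inv_eq_right_inv h4 ?_).symm
      rw [← map_mul, Units.mul_inv, map_one]

theorem Expands.unique {L : Subgroup G} {φ : G → ℤ} (hL : HasExpansions δ L φ) {x : R}
    {y y' : HahnSeries ℤ R} (h : Expands δ L φ x y) (h' : Expands δ L φ x y') : y = y' := by
  obtain ⟨B, _, p, q, hp, hq, hB, hm⟩ := hL
  obtain ⟨b, rfl, rfl⟩ := h.lift hp hB hm
  obtain ⟨b', h1, rfl⟩ := h'.lift hp hB hm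
  rw [hp h1]

theorem InRat.expands {S L : Subgroup G} {φ : G → ℤ} (hL : HasExpansions δ L φ) (hS : S ≤ L)
    {x : R} (h : InRat δ S x) : ∃ y, Expands δ L φ x y := by
  induction h with
  | mon c g hg => exact ⟨_, .mon c g (hS hg)⟩
  | add _ _ h h' =>
    obtain ⟨y, h⟩ := h
    obtain ⟨y', h'⟩ := h'
    exact ⟨_, h.add h'⟩
  | mul _ _ h h' =>
    obtain ⟨y, h⟩ := h
    obtain ⟨y', h'⟩ := h'
    exact ⟨_, h.mul h'⟩
  | inv _ h1 h2 h =>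
    obtain ⟨y, h⟩ := h
    obtain ⟨B, _, p, q, hp, hq, hB, hm⟩ := hL
    obtain ⟨b, rfl, rfl⟩ := h.lift hp hB hm
    obtain ⟨b, rfl⟩ := isUnit_of_map_isUnit hp hB ⟨⟨_, _, h1, h2⟩, rfl⟩
    refine ⟨q (b⁻¹ : Bˣ), .inv h h1 h2 ?_ ?_⟩
    · rw [← map_mul, Units.mul_inv, map_one]
    · rw [← map_mul, Units.inv_mul, map_one]

/-- A grading that is trivial on S gives no information on x; this is why `Good` only inspects
gradings that are nontrivial on S. -/
theorem InRat.expands_const {S L : Subgroup G} {φ : G → ℤ} (hS : S ≤ L)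
    (hφ : ∀ s ∈ S, φ s = 0) {x : R} (h : InRat δ S x) :
    Expands δ L φ x (HahnSeries.C x) := by
  induction h with
  | mon c g hg =>
    have := Expands.mon (δ := δ) (φ := φ) c g (hS hg)
    rwa [hφ g hg] at this
  | add _ _ h h' => rw [map_add]; exact h.add h'
  | mul _ _ h h' => rw [map_mul]; exact h.mul h'
  | inv _ h1 h2 h =>
    refine .inv h h1 h2 ?_ ?_
    · rw [← map_mul, h1, map_one]
    · rw [← map_mul, h2, map_one]

theorem InRat.mono {S S' : Subgroup G} (hS : S ≤ S') {x : R} (h : InRat δ S x) :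
    InRat δ S' x := by
  induction h with
  | mon c g hg => exact .mon c g (hS hg)
  | add _ _ h h' => exact h.add h'
  | mul _ _ h h' => exact h.mul h'
  | inv _ h1 h2 h => exact .inv h h1 h2

theorem InRat.zero (S : Subgroup G) : InRat δ S 0 := by
  simpa using InRat.mon (δ := δ) (0 : F) 1 S.one_mem

theorem InRat.one (S : Subgroup G) : InRat δ S 1 := by
  simpa [← MonoidAlgebra.one_def] using InRat.mon (δ := δ) (1 : F) 1 S.one_mem

theorem conj_mul_conj (u : Rˣ) (a b : R) :
    (u * a * (u⁻¹ : Rˣ)) * (u * b * (u⁻¹ : Rˣ)) = u * (a * b) * (u⁻¹ : Rˣ) := by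
  simp [mul_assoc]

theorem conj_single (v : Fˣ × G) (c : F) (g : G) :
    monomialUnit δ v * δ (MonoidAlgebra.single g c) * ((monomialUnit δ v)⁻¹ : Rˣ) =
      δ (MonoidAlgebra.single (v.2 * g * v.2⁻¹) (v.1 * c * ((v.1⁻¹ : Fˣ) : F))) := by
  rw [monomialUnit_inv_val, monomialUnit_val, ← map_mul, ← map_mul,
    MonoidAlgebra.single_mul_single, MonoidAlgebra.single_mul_single]

theorem InRat.conj (v : Fˣ × G) {S : Subgroup G} {x : R} (h : InRat δ S x) :
    InRat δ (conjSubgroup v.2 S) (monomialUnit δ v * x * ((monomialUnit δ v)⁻¹ : Rˣ)) := by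
  induction h with
  | mon c g hg =>
    rw [conj_single]
    exact .mon _ _ (mem_conjSubgroup.2 (by simpa [mul_assoc] using hg))
  | add _ _ h h' => rw [mul_add, add_mul]; exact h.add h'
  | mul _ _ h h' => rw [← conj_mul_conj]; exact h.mul h'
  | inv _ h1 h2 h => exact .inv h (by simp [conj_mul_conj, h1]) (by simp [conj_mul_conj, h2])

theorem Expands.conj (v : Fˣ × G) {L : Subgroup G} {φ : G → ℤ} {x : R} {y : HahnSeries ℤ R}
    (h : Expands δ L φ x y) :
    Expands δ (conjSubgroup v.2 L) (fun z => φ (v.2⁻¹ * z * v.2))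
      (monomialUnit δ v * x * ((monomialUnit δ v)⁻¹ : Rˣ))
      (Units.map (HahnSeries.C (Γ := ℤ) (R := R) : R →* HahnSeries ℤ R) (monomialUnit δ v) * y *
        ((Units.map (HahnSeries.C (Γ := ℤ) (R := R) : R →* HahnSeries ℤ R)
          (monomialUnit δ v))⁻¹ : (HahnSeries ℤ R)ˣ)) := by
  induction h with
  | mon c g hg =>
    have h0 := Expands.mon (δ := δ) (L := conjSubgroup v.2 L)
      (φ := fun z => φ (v.2⁻¹ * z * v.2)) (v.1 * c * ((v.1⁻¹ : Fˣ) : F)) (v.2 * g * v.2⁻¹)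
      (mem_conjSubgroup.2 (by simpa [mul_assoc] using hg))
    rw [← conj_single] at h0
    convert h0 using 1
    rw [← _root_.map_inv]
    simp [HahnSeries.C_apply, mul_assoc]
  | add _ _ h h' => rw [mul_add, add_mul, mul_add, add_mul]; exact h.add h'
  | mul _ _ h h' => rw [← conj_mul_conj, ← conj_mul_conj]; exact h.mul h'
  | inv _ h1 h2 h3 h4 h =>
    exact .inv h (by simp [conj_mul_conj, h1]) (by simp [conj_mul_conj, h2])
      (by rw [conj_mul_conj, h3, mul_one, Units.mul_inv])
      (by rw [conj_mul_conj, h4, mul_one, Units.mul_inv])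

end Expansions

/-! ### Elements whose iterated coefficients terminate, and the division subring they form -/

section Good

variable {F G R : Type u} [DivisionRing F] [Group G] [Ring R] (δ : MonoidAlgebra F G →+* R)

/-- The smallest relation between finitely generated subgroups `S` of `G` and elements `x` of the
rational closure of the image of `F[S]` such that `x` is related to `S` as soon as, for all
gradings which are not trivial on `S`, the coefficients of the expansion of `x` are, up to
trivial units, related to some subgroups. -/
def Good (S : Subgroup G) (x : R) : Prop :=
  ∀ P : Subgroup G → R → Prop,
    (∀ (S : Subgroup G) (x : R), S.FG → InRat δ S x →
      (∀ (L : Subgroup G) (φ : G → ℤ) (y : HahnSeries ℤ R), IsGrading L φ → S ≤ L →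
        (∃ s ∈ S, φ s ≠ 0) → Expands δ L φ x y →
        ∀ l, ∃ (v : Fˣ × G) (S' : Subgroup G), P S' (y.coeff l * monomialUnit δ v)) → P S x) →
    P S x

/-- A good element, up to trivial units. -/
def GoodUpToUnit (x : R) : Prop :=
  ∃ (v : Fˣ × G) (S : Subgroup G), Good δ S (x * monomialUnit δ v)

variable {δ}

/-- `Good` is the intersection of all relations closed under its rule; `Good.intro` is the
constructor and `Good.induct` the recursor. Gradings live on larger groups L ≥ S, so that a grading
of S ⊔ S' can be used for elements supported on S and on S' alike. -/
theorem Good.intro {S : Subgroup G} {x : R} (hS : S.FG) (hx : InRat δ S x)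
    (h : ∀ (L : Subgroup G) (φ : G → ℤ) (y : HahnSeries ℤ R), IsGrading L φ → S ≤ L →
        (∃ s ∈ S, φ s ≠ 0) → Expands δ L φ x y → ∀ l, GoodUpToUnit δ (y.coeff l)) :
    Good δ S x := by
  intro P hP
  refine hP S x hS hx fun L φ y hL hSL hs hy l => ?_
  obtain ⟨v, S', h'⟩ := h L φ y hL hSL hs hy l
  exact ⟨v, S', h' P hP⟩

theorem Good.induct {P : Subgroup G → R → Prop}
    (hP : ∀ (S : Subgroup G) (x : R), Good δ S x → S.FG → InRat δ S x →
      (∀ (L : Subgroup G) (φ : G → ℤ) (y : HahnSeries ℤ R), IsGrading L φ → S ≤ L →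
        (∃ s ∈ S, φ s ≠ 0) → Expands δ L φ x y →
        ∀ l, ∃ (v : Fˣ × G) (S' : Subgroup G), Good δ S' (y.coeff l * monomialUnit δ v) ∧
          P S' (y.coeff l * monomialUnit δ v)) → P S x)
    {S : Subgroup G} {x : R} (h : Good δ S x) : P S x := by
  refine (h (fun S x => Good δ S x ∧ P S x) fun S x hS hx h => ?_).2
  have hg : Good δ S x := by
    refine Good.intro hS hx fun L φ y hL hSL hs hy l => ?_
    obtain ⟨v, S', h', -⟩ := h L φ y hL hSL hs hy l
    exact ⟨v, S', h'⟩
  exact ⟨hg, hP S x hg hS hx h⟩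

theorem Good.inRat {S : Subgroup G} {x : R} (h : Good δ S x) : InRat δ S x :=
  Good.induct (P := fun S x => InRat δ S x) (fun _ _ _ _ h _ => h) h

theorem not_trivial_bot {L : Subgroup G} {φ : G → ℤ} (hL : IsGrading L φ) :
    ¬ ∃ s ∈ (⊥ : Subgroup G), φ s ≠ 0 := by
  rintro ⟨s, hs, h⟩
  rw [Subgroup.mem_bot.1 hs, hL.map_one] at h
  exact h rfl

theorem Good.zero : Good δ ⊥ (0 : R) :=
  Good.intro Subgroup.FG.bot (.zero _) fun _ _ _ hL _ h => (not_trivial_bot hL h).elim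

theorem Good.one : Good δ ⊥ (1 : R) :=
  Good.intro Subgroup.FG.bot (.one _) fun _ _ _ hL _ h => (not_trivial_bot hL h).elim

theorem Good.goodUpToUnit {S : Subgroup G} {x : R} (h : Good δ S x) : GoodUpToUnit δ x :=
  ⟨1, S, by simpa using h⟩

theorem GoodUpToUnit.mul_monomialUnit {x : R} (h : GoodUpToUnit δ x) (v : Fˣ × G) :
    GoodUpToUnit δ (x * monomialUnit δ v) := by
  obtain ⟨w, S, h⟩ := h
  exact ⟨v⁻¹ * w, S, by simpa [mul_assoc] using h⟩

theorem coeff_C_ite (x : R) (l : ℤ) :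
    (HahnSeries.C x : HahnSeries ℤ R).coeff l = if l = 0 then x else 0 := by
  simp [HahnSeries.C_apply, HahnSeries.coeff_single]

/-- The standing hypothesis: expansions with respect to all gradings. -/
def HasAllExpansions (δ : MonoidAlgebra F G →+* R) : Prop :=
  ∀ (L : Subgroup G) (φ : G → ℤ), IsGrading L φ → HasExpansions δ L φ

theorem Expands.eq_C (hE : HasAllExpansions δ) {S L : Subgroup G} {φ : G → ℤ}
    (hL : IsGrading L φ) (hS : S ≤ L) (hφ : ¬ ∃ s ∈ S, φ s ≠ 0) {x : R} (hx : InRat δ S x)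
    {y : HahnSeries ℤ R} (hy : Expands δ L φ x y) : y = HahnSeries.C x :=
  hy.unique (hE L φ hL) (hx.expands_const hS (by simpa using hφ))

theorem Good.coeff (hE : HasAllExpansions δ) {S L : Subgroup G} {φ : G → ℤ} {x : R}
    (h : Good δ S x) (hL : IsGrading L φ) (hS : S ≤ L) {y : HahnSeries ℤ R}
    (hy : Expands δ L φ x y) (l : ℤ) : GoodUpToUnit δ (y.coeff l) := by
  by_cases hφ : ∃ s ∈ S, φ s ≠ 0
  · refine Good.induct (P := fun S x => S ≤ L → (∃ s ∈ S, φ s ≠ 0) → Expands δ L φ x y →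
      GoodUpToUnit δ (y.coeff l)) (fun S x _ _ _ h hS hφ hy => ?_) h hS hφ hy
    obtain ⟨v, S', h, -⟩ := h L φ y hL hS hφ hy l
    exact ⟨v, S', h⟩
  · rw [hy.eq_C hE hL hS hφ h.inRat, coeff_C_ite]
    split_ifs
    · exact h.goodUpToUnit
    · exact Good.zero.goodUpToUnit

theorem InRat.monomialUnit {S : Subgroup G} {v : Fˣ × G} (h : v.2 ∈ S) :
    InRat δ S (monomialUnit δ v) :=
  .mon _ _ h

/-- Double induction on x and x'. The unit v is carried along because coefficients are good only up
to trivial units, and two summands may need different ones. If the grading is nontrivial on S or on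
S', some induction hypothesis handles each genuine sum of coefficients. -/
theorem Good.add (hE : HasAllExpansions δ) {S : Subgroup G} {x : R} (hx : Good δ S x) :
    ∀ (S' : Subgroup G) (x' : R), Good δ S' x' → ∀ v : Fˣ × G,
      Good δ (S ⊔ S' ⊔ Subgroup.zpowers v.2) (x + x' * monomialUnit δ v) := by
  refine Good.induct (P := fun S x => ∀ (S' : Subgroup G) (x' : R), Good δ S' x' →
    ∀ v : Fˣ × G, Good δ (S ⊔ S' ⊔ Subgroup.zpowers v.2) (x + x' * monomialUnit δ v))
    (fun S x hx hS hxr hx1 S' x' hx' => ?_) hx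
  refine Good.induct (P := fun S' x' => ∀ v : Fˣ × G,
    Good δ (S ⊔ S' ⊔ Subgroup.zpowers v.2) (x + x' * monomialUnit δ v))
    (fun S' x' hx' hS' hxr' hx1' v => ?_) hx'
  have l1 : S ≤ S ⊔ S' ⊔ Subgroup.zpowers v.2 := le_sup_left.trans le_sup_left
  have l2 : S' ≤ S ⊔ S' ⊔ Subgroup.zpowers v.2 := le_sup_right.trans le_sup_left
  have l3 : v.2 ∈ S ⊔ S' ⊔ Subgroup.zpowers v.2 :=
    le_sup_right (a := S ⊔ S') (Subgroup.mem_zpowers v.2)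
  refine Good.intro ((hS.sup hS').sup ?_) ((hxr.mono l1).add ((hxr'.mono l2).mul (.monomialUnit l3)))
    fun L φ z hL hSL hs hz l => ?_
  · exact (Subgroup.fg_iff _).2 ⟨{v.2}, (Subgroup.zpowers_eq_closure _).symm,
      Set.finite_singleton _⟩
  obtain ⟨y, hy⟩ := hxr.expands (hE L φ hL) (l1.trans hSL)
  obtain ⟨y', hy'⟩ := hxr'.expands (hE L φ hL) (l2.trans hSL)
  have hz' : z = y + y' * HahnSeries.single (φ v.2) (monomialUnit δ v : R) :=
    hz.unique (hE L φ hL) (hy.add (hy'.mul (.mon _ _ (hSL l3))))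
  rw [hz', HahnSeries.coeff_add, HahnSeries.coeff_mul_single]
  have g1 := hx.coeff hE hL (l1.trans hSL) hy l
  have g2 := hx'.coeff hE hL (l2.trans hSL) hy' (l - φ v.2)
  by_cases c1 : ∃ s ∈ S, φ s ≠ 0
  · obtain ⟨w, T, -, ih⟩ := hx1 L φ y hL (l1.trans hSL) c1 hy l
    obtain ⟨w', T', g2⟩ := g2
    have := (ih T' _ g2 (w'⁻¹ * v * w)).goodUpToUnit.mul_monomialUnit w⁻¹
    simpa [add_mul, mul_assoc] using this
  have e1 := hy.eq_C hE hL (l1.trans hSL) c1 hxr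
  by_cases c2 : ∃ s ∈ S', φ s ≠ 0
  · rw [e1, coeff_C_ite]
    split_ifs with h0
    · obtain ⟨w', T', -, ih⟩ := hx1' L φ y' hL (l2.trans hSL) c2 hy' (l - φ v.2)
      simpa [mul_assoc] using (ih (w'⁻¹ * v)).goodUpToUnit
    · rw [zero_add]
      exact g2.mul_monomialUnit v
  have e2 := hy'.eq_C hE hL (l2.trans hSL) c2 hxr'
  -- With the grading trivial on S and S', only v can make it nontrivial; then x and x'v sit in
  -- different degrees and are never added.
  have h0 : φ v.2 ≠ 0 := by
    intro h0
    obtain ⟨s, hs, hs0⟩ := hs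
    have : S ⊔ S' ⊔ Subgroup.zpowers v.2 ≤ gradingKer hL :=
      sup_le (sup_le (fun s hs => ⟨hSL (l1 hs), by_contra fun h => c1 ⟨s, hs, h⟩⟩)
        fun s hs => ⟨hSL (l2 hs), by_contra fun h => c2 ⟨s, hs, h⟩⟩)
        (Subgroup.zpowers_le.2 ⟨hSL l3, h0⟩)
    exact hs0 (this hs).2
  rw [e1, coeff_C_ite]
  split_ifs with h1
  · rw [e2, coeff_C_ite, if_neg (by omega), zero_mul, add_zero]
    exact hx.goodUpToUnit
  · rw [zero_add]
    exact g2.mul_monomialUnit v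

theorem GoodUpToUnit.add (hE : HasAllExpansions δ) {x x' : R} (h : GoodUpToUnit δ x)
    (h' : GoodUpToUnit δ x') : GoodUpToUnit δ (x + x') := by
  obtain ⟨w, T, h⟩ := h
  obtain ⟨w', T', h'⟩ := h'
  have := (h.add hE T' _ h' (w'⁻¹ * w)).goodUpToUnit.mul_monomialUnit w⁻¹
  simpa [add_mul, mul_assoc] using this

/-- Conjugation transports gradings and expansions. It is needed to move a trivial unit from between
two factors of a product to the right-hand end. -/
theorem Good.conj {S : Subgroup G} {x : R} (hx : Good δ S x) :
    ∀ v : Fˣ × G, Good δ (conjSubgroup v.2 S)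
      (monomialUnit δ v * x * ((monomialUnit δ v)⁻¹ : Rˣ)) := by
  refine Good.induct (P := fun S x => ∀ v : Fˣ × G, Good δ (conjSubgroup v.2 S)
      (monomialUnit δ v * x * ((monomialUnit δ v)⁻¹ : Rˣ))) (fun S x hx hS hxr hx1 v => ?_) hx
  refine Good.intro ?_ (hxr.conj v) fun L φ y hL hSL hs hy l => ?_
  · exact fg_conjSubgroup hS _
  have hy' := hy.conj v⁻¹
  have ex : monomialUnit δ v⁻¹ * (monomialUnit δ v * x * ((monomialUnit δ v)⁻¹ : Rˣ)) *
      ((monomialUnit δ v⁻¹)⁻¹ : Rˣ) = x := by simp [mul_assoc]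
  rw [ex] at hy'
  have hs' : ∃ s ∈ S, φ (v.2⁻¹⁻¹ * s * v.2⁻¹) ≠ 0 := by
    obtain ⟨s, hs, h⟩ := hs
    exact ⟨_, mem_conjSubgroup.1 hs, by simpa [mul_assoc] using h⟩
  obtain ⟨w, T, -, h⟩ := hx1 _ _ _ (hL.conj v.2⁻¹) (fun s hs => mem_conjSubgroup.2 (hSL
    (mem_conjSubgroup.2 (by simpa [mul_assoc] using hs)))) hs' hy' l
  refine ⟨v * w * v⁻¹, conjSubgroup v.2 T, ?_⟩
  convert h v using 1
  rw [← _root_.map_inv]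
  simp [HahnSeries.C_apply, mul_assoc]

theorem GoodUpToUnit.coeff_mul (hE : HasAllExpansions δ) {y y' : HahnSeries ℤ R}
    (h : ∀ i j, GoodUpToUnit δ (y.coeff i * y'.coeff j)) (l : ℤ) :
    GoodUpToUnit δ ((y * y').coeff l) := by
  rw [HahnSeries.coeff_mul]
  exact Finset.sum_induction _ _ (fun _ _ h h' => h.add hE h') Good.zero.goodUpToUnit
    fun _ _ => h _ _

/-- Each coefficient of a product is a finite sum of products of coefficients; sums are already
handled, and a grading nontrivial on S ⊔ S' is nontrivial on S or S', so one of the two inductions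
applies to each product. -/
theorem Good.mul (hE : HasAllExpansions δ) {S : Subgroup G} {x : R} (hx : Good δ S x) :
    ∀ (S' : Subgroup G) (x' : R), Good δ S' x' → Good δ (S ⊔ S') (x * x') := by
  refine Good.induct (P := fun S x => ∀ (S' : Subgroup G) (x' : R), Good δ S' x' →
    Good δ (S ⊔ S') (x * x')) (fun S x hx hS hxr hx1 S' x' hx' => ?_) hx
  refine Good.induct (P := fun S' x' => Good δ (S ⊔ S') (x * x'))
    (fun S' x' hx' hS' hxr' hx1' => ?_) hx'
  have l1 : S ≤ S ⊔ S' := le_sup_left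
  have l2 : S' ≤ S ⊔ S' := le_sup_right
  refine Good.intro (hS.sup hS') ((hxr.mono l1).mul (hxr'.mono l2))
    fun L φ z hL hSL hs hz l => ?_
  obtain ⟨y, hy⟩ := hxr.expands (hE L φ hL) (l1.trans hSL)
  obtain ⟨y', hy'⟩ := hxr'.expands (hE L φ hL) (l2.trans hSL)
  rw [hz.unique (hE L φ hL) (hy.mul hy')]
  by_cases c1 : ∃ s ∈ S, φ s ≠ 0
  · refine GoodUpToUnit.coeff_mul hE (fun i j => ?_) l
    obtain ⟨w, T, -, ih⟩ := hx1 L φ y hL (l1.trans hSL) c1 hy i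
    obtain ⟨w', T', g2⟩ := hx'.coeff hE hL (l2.trans hSL) hy' j
    have := (ih _ _ (g2.conj w⁻¹)).goodUpToUnit.mul_monomialUnit (w⁻¹ * w'⁻¹)
    simpa [mul_assoc] using this
  rw [hy.eq_C hE hL (l1.trans hSL) c1 hxr, HahnSeries.C_apply, HahnSeries.coeff_single_zero_mul]
  by_cases c2 : ∃ s ∈ S', φ s ≠ 0
  · obtain ⟨w', T', -, ih⟩ := hx1' L φ y' hL (l2.trans hSL) c2 hy' l
    simpa [mul_assoc] using ih.goodUpToUnit.mul_monomialUnit w'⁻¹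
  exfalso
  obtain ⟨s, hs, hs0⟩ := hs
  have : S ⊔ S' ≤ gradingKer hL :=
    sup_le (fun s hs => ⟨hSL (l1 hs), by_contra fun h => c1 ⟨s, hs, h⟩⟩)
      fun s hs => ⟨hSL (l2 hs), by_contra fun h => c2 ⟨s, hs, h⟩⟩
  exact hs0 (this hs).2

theorem GoodUpToUnit.mul (hE : HasAllExpansions δ) {x x' : R} (h : GoodUpToUnit δ x)
    (h' : GoodUpToUnit δ x') : GoodUpToUnit δ (x * x') := by
  obtain ⟨w, T, h⟩ := h
  obtain ⟨w', T', h'⟩ := h'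
  have := (h.mul hE _ _ (h'.conj w⁻¹)).goodUpToUnit.mul_monomialUnit (w⁻¹ * w'⁻¹)
  simpa [mul_assoc] using this

theorem goodUpToUnit_single (c : F) (g : G) : GoodUpToUnit δ (δ (MonoidAlgebra.single g c)) := by
  by_cases hc : c = 0
  · simpa [hc] using Good.zero.goodUpToUnit
  · have := Good.one.goodUpToUnit.mul_monomialUnit (δ := δ) (Units.mk0 c hc, g)
    rwa [one_mul] at this

variable (δ) in
/-- The subring of elements which are good up to trivial units. -/
def goodSubring (hE : HasAllExpansions δ) : Subring R where
  carrier := {x | GoodUpToUnit δ x}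
  mul_mem' h h' := GoodUpToUnit.mul hE h h'
  one_mem' := Good.one.goodUpToUnit
  add_mem' h h' := GoodUpToUnit.add hE h h'
  zero_mem' := Good.zero.goodUpToUnit
  neg_mem' {x} h := by
    have := GoodUpToUnit.mul hE (goodUpToUnit_single (-1) 1) h
    rw [MonoidAlgebra.single_neg, ← MonoidAlgebra.one_def, map_neg, map_one, neg_one_mul] at this
    exact this

theorem HahnSeries.isRightRegular_of_isUnit_leadingCoeff {y : HahnSeries ℤ R}
    (h : IsUnit y.leadingCoeff) : IsRightRegular y := by
  refine (isRightRegular_iff_left_eq_zero_of_mul).2 fun z hz => ?_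
  by_contra h0
  have := HahnSeries.coeff_mul_order_add_order z y
  rw [hz, HahnSeries.coeff_zero] at this
  exact HahnSeries.leadingCoeff_ne_zero.2 h0 ((h.mul_left_eq_zero).1 this.symm)

/-- In degree `y.order + l`, the equation y z = 1 expresses the leading coefficient of y times z_l
through the z_j with j < l. Multiplying by `a` on the left solves for z_l, recursively from
`z.order` upwards. -/
theorem HahnSeries.coeff_mem_of_mul_eq_one {T : Subring R} {y z : HahnSeries ℤ R} {a : R}
    (hy : ∀ l, y.coeff l ∈ T) (ha : a ∈ T) (hay : a * y.leadingCoeff = 1) (hyz : y * z = 1)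
    (l : ℤ) : z.coeff l ∈ T := by
  suffices ∀ n : ℕ, ∀ l < z.order + n, z.coeff l ∈ T from
    this (l - z.order + 1).toNat l (by omega)
  intro n
  induction n with
  | zero =>
    intro l hl
    rw [HahnSeries.coeff_eq_zero_of_lt_order (by simpa using hl)]
    exact T.zero_mem
  | succ n ih =>
    intro l hl
    by_cases hl' : l < z.order + n
    · exact ih l hl'
    by_cases hz : z.coeff l = 0
    · rw [hz]
      exact T.zero_mem
    by_cases hy0 : y.coeff y.order = 0
    · rw [HahnSeries.leadingCoeff_eq, hy0, mul_zero] at hay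
      rw [← one_mul (z.coeff l), ← hay, zero_mul]
      exact T.zero_mem
    have h1 : (y * z).coeff (y.order + l) ∈ T := by
      rw [hyz, HahnSeries.coeff_one]
      split_ifs
      exacts [T.one_mem, T.zero_mem]
    rw [HahnSeries.coeff_mul, ← Finset.add_sum_erase _ _ (a := (y.order, l))
      (Finset.mem_antidiagonal.2 ⟨hy0, hz, rfl⟩)] at h1
    have h2 := T.sub_mem h1 (T.sum_mem (t := (Finset.antidiagonal y.isPWO_support z.isPWO_support
      (y.order + l)).erase (y.order, l)) (f := fun ij => y.coeff ij.1 * z.coeff ij.2) ?_)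
    · rw [add_sub_cancel_right] at h2
      have h3 := T.mul_mem ha h2
      rwa [← mul_assoc, ← HahnSeries.leadingCoeff_eq, hay, one_mul] at h3
    · rintro ⟨i, j⟩ hij
      obtain ⟨hne, hij⟩ := Finset.mem_erase.1 hij
      obtain ⟨hi, hj, hij⟩ := Finset.mem_antidiagonal.1 hij
      have hi' : y.order ≤ i := HahnSeries.order_le_of_coeff_ne_zero hi
      have hij' : i + j = y.order + l := hij
      refine T.mul_mem (hy i) (ih j ?_)
      have : i ≠ y.order := fun h => hne (by rw [h, show j = l by omega])
      omega

theorem InRat.eq_of_bot {x : R} (h : InRat δ ⊥ x) :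
    ∃ c : F, x = δ (MonoidAlgebra.single 1 c) := by
  induction h with
  | mon c g hg => exact ⟨c, by rw [Subgroup.mem_bot.1 hg]⟩
  | add _ _ h h' =>
    obtain ⟨c, rfl⟩ := h
    obtain ⟨c', rfl⟩ := h'
    exact ⟨c + c', by rw [MonoidAlgebra.single_add, map_add]⟩
  | mul _ _ h h' =>
    obtain ⟨c, rfl⟩ := h
    obtain ⟨c', rfl⟩ := h'
    exact ⟨c * c', by rw [← map_mul, MonoidAlgebra.single_mul_single, mul_one]⟩
  | @inv x x' _ h1 h2 h =>
    obtain ⟨c, rfl⟩ := h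
    by_cases hc : c = 0
    · refine ⟨0, ?_⟩
      rw [← one_mul x', ← h1, hc]
      simp
    · refine ⟨c⁻¹, left_inv_eq_right_inv h2 ?_⟩
      rw [← map_mul, MonoidAlgebra.single_mul_single, mul_one, mul_inv_cancel₀ hc,
        ← MonoidAlgebra.one_def, map_one]

/-- If S is trivial, x comes from F. Otherwise S has a grading; by induction the leading coefficient
of the expansion is a unit, so the expansion is right regular. Hence the common lift of x and its
expansion to B is right regular, thus a unit. -/
theorem Good.eq_zero_or_isUnit (hG : IsLocallyIndicable G) (hE : HasAllExpansions δ)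
    {S : Subgroup G} {x : R} (hx : Good δ S x) : x = 0 ∨ IsUnit x := by
  refine Good.induct (P := fun S x => x = 0 ∨ IsUnit x) (fun S x hx hS hxr hx1 => ?_) hx
  by_cases hS0 : S = ⊥
  · subst hS0
    obtain ⟨c, rfl⟩ := hxr.eq_of_bot
    by_cases hc : c = 0
    · simp [hc]
    · exact .inr (monomialUnit δ (Units.mk0 c hc, 1)).isUnit
  obtain ⟨φ, hφ⟩ := exists_isGrading hG hS hS0
  obtain ⟨y, hy⟩ := hxr.expands (hE S φ hφ) le_rfl
  have hs : ∃ s ∈ S, φ s ≠ 0 := by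
    obtain ⟨t, ht, h⟩ := hφ.surj
    exact ⟨t, ht, by omega⟩
  obtain ⟨B, _, p, q, hp, hq, hB, hm⟩ := hE S φ hφ
  obtain ⟨b, rfl, rfl⟩ := hy.lift hp hB hm
  by_cases hb : b = 0
  · simp [hb]
  refine .inr (IsUnit.map p (hB b fun c c' hc => hq ?_))
  refine HahnSeries.isRightRegular_of_isUnit_leadingCoeff (y := q b) ?_ (by
    simpa using congrArg q hc)
  have h0 : (q b).leadingCoeff ≠ 0 :=
    HahnSeries.leadingCoeff_ne_zero.2 ((map_ne_zero_iff q hq).2 hb)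
  obtain ⟨v, T, -, h⟩ := hx1 S φ _ hφ le_rfl hs hy (q b).order
  rw [← HahnSeries.leadingCoeff_eq, Units.mul_left_eq_zero, Units.isUnit_mul_units] at h
  exact h.resolve_left h0

/-- The coefficients of the inverse series are built by ring operations from those of y and a left
inverse of its leading coefficient, which is good up to units by induction. -/
theorem Good.inv [Nontrivial R] (hG : IsLocallyIndicable G) (hE : HasAllExpansions δ)
    {S : Subgroup G} {x : R} (hx : Good δ S x) :
    ∀ x', x * x' = 1 → x' * x = 1 → Good δ S x' := by
  refine Good.induct (P := fun S x => ∀ x', x * x' = 1 → x' * x = 1 → Good δ S x')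
    (fun S x hx hS hxr hx1 x' h1 h2 => ?_) hx
  refine Good.intro hS (hxr.inv h1 h2) fun L φ z hL hSL hs hz l => ?_
  obtain ⟨y, hy⟩ := hxr.expands (hE L φ hL) hSL
  have hyz : y * z = 1 := by
    have e := hE L φ hL
    refine (hy.mul hz).unique e ?_
    rw [h1]
    simpa using (InRat.one (δ := δ) ⊥).expands_const (φ := φ) (bot_le (a := L))
      (by simpa using hL.map_one)
  have hy0 : y.leadingCoeff ≠ 0 := by
    rw [HahnSeries.leadingCoeff_ne_zero]
    rintro rfl
    simp at hyz
  have hu : ∃ a, GoodUpToUnit δ a ∧ a * y.leadingCoeff = 1 := by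
    obtain ⟨v, T, h, ih⟩ := hx1 L φ y hL hSL hs hy y.order
    rw [HahnSeries.leadingCoeff_eq] at hy0 ⊢
    obtain ⟨⟨a, b, hab, hba⟩, h⟩ := (h.eq_zero_or_isUnit hG hE).resolve_left
      (by rwa [Units.mul_left_eq_zero])
    simp only at h
    rw [← h] at ih
    refine ⟨monomialUnit δ v * b, ?_, ?_⟩
    · refine GoodUpToUnit.mul hE (goodUpToUnit_single _ _) (ih b hab hba).goodUpToUnit
    · rw [Units.eq_mul_inv_iff_mul_eq _ |>.2 h.symm]
      rw [mul_assoc, ← mul_assoc b, hba, one_mul, Units.mul_inv]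
  obtain ⟨a, ha, hay⟩ := hu
  exact HahnSeries.coeff_mem_of_mul_eq_one (T := goodSubring δ hE)
    (fun l => hx.coeff hE hL hSL hy l) ha hay hyz l

/-- If `δ : F[G] → R` has expansions with respect to all gradings, and `G` is locally indicable,
then the image of `δ` is contained in a division subring of `R`. -/
theorem exists_division_subring [Nontrivial R] (hG : IsLocallyIndicable G)
    (hE : HasAllExpansions δ) :
    ∃ T : Subring R, (∀ a, δ a ∈ T) ∧ ∀ x ∈ T, x ≠ 0 → ∃ y ∈ T, x * y = 1 ∧ y * x = 1 := by
  refine ⟨goodSubring δ hE, fun a => ?_, ?_⟩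
  · induction a using MonoidAlgebra.induction_linear with
    | zero => rw [map_zero]; exact Subring.zero_mem _
    | add a b ha hb => rw [map_add]; exact Subring.add_mem _ ha hb
    | single g c => exact goodUpToUnit_single c g
  · rintro x ⟨v, S, h⟩ hx
    obtain ⟨⟨a, b, hab, hba⟩, h'⟩ := (h.eq_zero_or_isUnit hG hE).resolve_left
      (by rwa [Units.mul_left_eq_zero])
    simp only at h'
    rw [← h'] at h
    have hg := GoodUpToUnit.mul hE (goodUpToUnit_single (δ := δ) v.1 v.2)
      (h.inv hG hE b hab hba).goodUpToUnit
    have e : x = a * ((monomialUnit δ v)⁻¹ : Rˣ) := (Units.eq_mul_inv_iff_mul_eq _).2 h'.symm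
    refine ⟨monomialUnit δ v * b, hg, ?_, ?_⟩
    · rw [e]
      simp [mul_assoc, hab]
    · rw [e, mul_assoc, ← mul_assoc b, hba]
      simp

end Good

/-! ### Skew Laurent polynomials inside a division ring -/

section SkewLaurent

variable {D : Type u} [DivisionRing D]

theorem HahnSeries.isUnit_of_ne_zero {y : HahnSeries ℤ D} (hy : y ≠ 0) : IsUnit y := by
  have hc : y.coeff y.order ≠ 0 := by
    rw [← HahnSeries.leadingCoeff_eq]
    exact HahnSeries.leadingCoeff_ne_zero.2 hy
  have h1 : IsUnit (HahnSeries.single y.order (1 : D)) :=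
    ⟨⟨HahnSeries.single y.order 1, HahnSeries.single (-y.order) 1, by simp, by simp⟩, rfl⟩
  have hp : PowerSeries.constantCoeff (LaurentSeries.powerSeriesPart y) =
      (Units.mk0 _ hc : D) := by
    rw [← PowerSeries.coeff_zero_eq_constantCoeff_apply, LaurentSeries.powerSeriesPart_coeff]
    simp
  have h2 : IsUnit (LaurentSeries.powerSeriesPart y) :=
    ⟨⟨_, _, PowerSeries.mul_invOfUnit _ _ hp, PowerSeries.invOfUnit_mul _ _ hp⟩, rfl⟩
  rw [← LaurentSeries.single_order_mul_powerSeriesPart y]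
  exact h1.mul (h2.map _)

variable {E : Subfield D} {τ : Dˣ}

/-- The homogeneous elements of degree `n` in the ring of skew Laurent polynomials in `τ` with
coefficients in `E`. -/
def IsHomogeneous (E : Subfield D) (τ : Dˣ) (n : ℤ) (x : D) : Prop :=
  x * ((τ ^ (-n) : Dˣ) : D) ∈ E

theorem IsHomogeneous.mul (hτ : ∀ x ∈ E, ∀ n : ℤ, ((τ ^ n : Dˣ) : D) * x * ((τ ^ (-n) : Dˣ) : D) ∈ E)
    {m n : ℤ} {x y : D} (hx : IsHomogeneous E τ m x) (hy : IsHomogeneous E τ n y) :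
    IsHomogeneous E τ (m + n) (x * y) := by
  have := E.mul_mem hx (hτ _ hy m)
  unfold IsHomogeneous
  convert this using 1
  rw [neg_add_rev, zpow_add, Units.val_mul]
  simp only [mul_assoc]
  rw [zpow_neg τ m, Units.inv_mul_cancel_left]

theorem isHomogeneous_zpow (n : ℤ) : IsHomogeneous E τ n ((τ ^ n : Dˣ) : D) := by
  unfold IsHomogeneous
  rw [← Units.val_mul, ← zpow_add]
  simp

theorem IsHomogeneous.eq_smul {n : ℤ} {x : D} (hx : IsHomogeneous E τ n x) :
    x = (⟨_, hx⟩ : E) • ((τ ^ n : Dˣ) : D) := by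
  change x = x * ((τ ^ (-n) : Dˣ) : D) * ((τ ^ n : Dˣ) : D)
  rw [mul_assoc, ← Units.val_mul, ← zpow_add]
  simp

theorem isHomogeneous_smul_zpow (a : E) (n : ℤ) :
    IsHomogeneous E τ n ((a : D) * ((τ ^ n : Dˣ) : D)) := by
  unfold IsHomogeneous
  rw [mul_assoc, ← Units.val_mul, ← zpow_add]
  simp

/-- The ring of skew Laurent polynomials in `τ` with coefficients in `E`, graded by degree. -/
def skewLaurent (hτ : ∀ x ∈ E, ∀ n : ℤ, ((τ ^ n : Dˣ) : D) * x * ((τ ^ (-n) : Dˣ) : D) ∈ E) :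
    Subring (AddMonoidAlgebra D ℤ) where
  -- The variable of the ambient ring is central: the twist sits in the coefficients, the one in
  -- degree n being e τⁿ with e in E. Thus evaluation at 1 is a ring homomorphism to D.
  carrier := {P | ∀ n, IsHomogeneous E τ n (P.coeff n)}
  mul_mem' {P Q} hP hQ n := by
    rw [AddMonoidAlgebra.coeff_mul]
    unfold IsHomogeneous
    rw [Finsupp.sum, Finset.sum_mul]
    refine E.sum_mem fun i _ => ?_
    rw [Finsupp.sum, Finset.sum_mul]
    refine E.sum_mem fun j _ => ?_
    split_ifs with h
    · subst h
      exact (hP i).mul hτ (hQ j)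
    · simp
  one_mem' n := by
    rw [AddMonoidAlgebra.one_def, AddMonoidAlgebra.coeff_single, Finsupp.single_apply]
    unfold IsHomogeneous
    split_ifs with h
    · subst h
      simp
    · simp
  add_mem' hP hQ n := by
    have := E.add_mem (hP n) (hQ n)
    rwa [← add_mul] at this
  zero_mem' n := by
    unfold IsHomogeneous
    simp
  neg_mem' hP n := by
    have := E.neg_mem (hP n)
    rwa [← neg_mul] at this

/-- Evaluation of Laurent polynomials at `1`. -/
noncomputable def evalOne : AddMonoidAlgebra D ℤ →+* D :=
  AddMonoidAlgebra.liftNCRingHom (RingHom.id D) 1 fun _ _ => Commute.one_right _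

theorem evalOne_single (n : ℤ) (x : D) : evalOne (AddMonoidAlgebra.single n x) = x :=
  (AddMonoidAlgebra.liftNC_single _ _ _ _).trans (mul_one x)

theorem evalOne_eq_sum (P : AddMonoidAlgebra D ℤ) :
    evalOne P = ∑ i ∈ P.coeff.support, P.coeff i := by
  conv_lhs => rw [← AddMonoidAlgebra.sum_coeff_single P]
  rw [Finsupp.sum, map_sum]
  simp only [evalOne_single]

/-- Laurent polynomials as Laurent series. -/
noncomputable def toLaurentSeries : AddMonoidAlgebra D ℤ →+* HahnSeries ℤ D :=
  AddMonoidAlgebra.liftNCRingHom HahnSeries.C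
    { toFun := fun n => HahnSeries.single n.toAdd 1
      map_one' := rfl
      map_mul' := fun a b => by simp } fun x y => by
        simp [Commute, SemiconjBy, HahnSeries.C_apply]

theorem toLaurentSeries_single (n : ℤ) (x : D) :
    toLaurentSeries (AddMonoidAlgebra.single n x) = HahnSeries.single n x := by
  refine (AddMonoidAlgebra.liftNC_single _ _ _ _).trans ?_
  simp [HahnSeries.C_apply, -HahnSeries.single_zero_mul_eq_smul]

theorem coeff_toLaurentSeries (P : AddMonoidAlgebra D ℤ) (i : ℤ) :
    (toLaurentSeries P).coeff i = P.coeff i := by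
  induction P using AddMonoidAlgebra.induction_linear with
  | zero => simp
  | add P Q hP hQ => simp [hP, hQ]
  | single n x =>
    rw [toLaurentSeries_single, AddMonoidAlgebra.coeff_single, HahnSeries.coeff_single,
      Finsupp.single_apply]
    simp [eq_comm]

/-- The value at 1 is a combination of the powers of τ with coefficients in E, and these powers are
independent. -/
theorem eq_zero_of_evalOne_eq_zero
    (hτ : ∀ x ∈ E, ∀ n : ℤ, ((τ ^ n : Dˣ) : D) * x * ((τ ^ (-n) : Dˣ) : D) ∈ E)
    (hli : LinearIndependent E fun n : ℤ => ((τ ^ n : Dˣ) : D)) {P : AddMonoidAlgebra D ℤ}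
    (hP : P ∈ skewLaurent hτ) (h : evalOne P = 0) : P = 0 := by
  rw [evalOne_eq_sum] at h
  have h' := linearIndependent_iff'.1 hli P.coeff.support (fun i => ⟨_, hP i⟩) (by
    rw [← h]
    exact Finset.sum_congr rfl fun i _ => (hP i).eq_smul.symm)
  rw [← AddMonoidAlgebra.coeff_eq_zero]
  ext i
  by_cases hi : i ∈ P.coeff.support
  · rw [(hP i).eq_smul, h' i hi, zero_smul, Finsupp.zero_apply]
  · simpa using hi

theorem zpow_mul_evalOne_mem_span
    (hτ : ∀ x ∈ E, ∀ n : ℤ, ((τ ^ n : Dˣ) : D) * x * ((τ ^ (-n) : Dˣ) : D) ∈ E)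
    {P : AddMonoidAlgebra D ℤ} (hP : P ∈ skewLaurent hτ) {a b : ℤ}
    (hs : ∀ i ∈ P.coeff.support, i ∈ Finset.Icc a b) {N : ℕ} (n : Fin N) :
    ((τ ^ (n : ℤ) : Dˣ) : D) * evalOne P ∈
      Submodule.span E ((fun n : ℤ => ((τ ^ n : Dˣ) : D)) '' Finset.Icc a (b + N)) := by
  rw [evalOne_eq_sum, Finset.mul_sum]
  refine Submodule.sum_mem _ fun i hi => ?_
  rw [((isHomogeneous_zpow (n : ℤ)).mul hτ (hP i)).eq_smul]
  refine Submodule.smul_mem _ _ (Submodule.subset_span ⟨_, ?_, rfl⟩)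
  have := Finset.mem_Icc.1 (hs i hi)
  simp only [Finset.coe_Icc, Set.mem_Icc]
  omega

/-- The Ore condition, by counting dimensions over E: the multiples of P and Q by low powers of τ
outnumber the powers of τ that span them. -/
theorem exists_common_multiple
    (hτ : ∀ x ∈ E, ∀ n : ℤ, ((τ ^ n : Dˣ) : D) * x * ((τ ^ (-n) : Dˣ) : D) ∈ E)
    (hli : LinearIndependent E fun n : ℤ => ((τ ^ n : Dˣ) : D)) {P Q : AddMonoidAlgebra D ℤ}
    (hP : P ∈ skewLaurent hτ) (hQ : Q ∈ skewLaurent hτ) (hQ0 : Q ≠ 0) :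
    ∃ A ∈ skewLaurent hτ, ∃ B ∈ skewLaurent hτ, A ≠ 0 ∧ A * P = B * Q := by
  classical
  obtain ⟨d, hd⟩ : ∃ d : ℕ, ∀ i ∈ P.coeff.support ∪ Q.coeff.support,
      i ∈ Finset.Icc (-(d : ℤ)) d := by
    refine ⟨(P.coeff.support ∪ Q.coeff.support).sup Int.natAbs, fun i hi => ?_⟩
    have := Finset.le_sup (f := Int.natAbs) hi
    rw [Finset.mem_Icc]
    omega
  -- There are 2N = 4d + 4 multiples, in a span of at most 2d + N + 1 = 4d + 3 powers τⁿ with −d ≤ n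
  -- ≤ d + N.
  set N := 2 * d + 2 with hN
  let v : Fin N ⊕ Fin N → D := Sum.elim (fun n => ((τ ^ (n : ℤ) : Dˣ) : D) * evalOne P)
    (fun n => ((τ ^ (n : ℤ) : Dˣ) : D) * evalOne Q)
  have hv : ¬ LinearIndependent E v := by
    intro h
    have := linearIndependent_le_span' v h
      ((Finset.Icc (-(d : ℤ)) (d + N)).image (fun n : ℤ => ((τ ^ n : Dˣ) : D))) (by
        rintro _ ⟨n | n, rfl⟩
        · have := zpow_mul_evalOne_mem_span hτ hP
            (fun i hi => hd i (Finset.mem_union_left _ hi)) n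
          simpa [v] using this
        · have := zpow_mul_evalOne_mem_span hτ hQ
            (fun i hi => hd i (Finset.mem_union_right _ hi)) n
          simpa [v] using this)
    rw [Cardinal.mk_fintype, Nat.cast_le, Fintype.card_sum, Fintype.card_fin] at this
    simp only [Finset.coe_sort_coe, Fintype.card_coe] at this
    have h2 := this.trans Finset.card_image_le
    rw [Int.card_Icc] at h2
    omega
  obtain ⟨g, hg, i, hi⟩ := Fintype.not_linearIndependent_iff.1 hv
  rw [Fintype.sum_sum_type] at hg
  let mk : (Fin N → E) → AddMonoidAlgebra D ℤ := fun f =>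
    ∑ n : Fin N, AddMonoidAlgebra.single ((n : ℕ) : ℤ) ((f n : D) * ((τ ^ ((n : ℕ) : ℤ) : Dˣ) : D))
  have hmk : ∀ f, mk f ∈ skewLaurent hτ := by
    intro f
    refine Subring.sum_mem _ fun n _ m => ?_
    rw [AddMonoidAlgebra.coeff_single, Finsupp.single_apply]
    split_ifs with h
    · rw [← h]
      exact isHomogeneous_smul_zpow _ _
    · unfold IsHomogeneous
      simp
  have hmk0 : ∀ f, mk f = 0 → f = 0 := by
    intro f hf
    ext n
    have := congrArg (fun P => P.coeff ((n : ℕ) : ℤ)) hf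
    simp only [mk, AddMonoidAlgebra.coeff_sum, AddMonoidAlgebra.coeff_single,
      Finsupp.finsetSum_apply, Finsupp.single_apply, AddMonoidAlgebra.coeff_zero,
      Finsupp.zero_apply, Nat.cast_inj, Fin.val_inj] at this
    simpa using this
  have hev : ∀ (f : Fin N → E) (P : AddMonoidAlgebra D ℤ), evalOne (mk f * P) =
      ∑ n : Fin N, f n • (((τ ^ ((n : ℕ) : ℤ) : Dˣ) : D) * evalOne P) := by
    intro f P
    rw [map_mul, map_sum, Finset.sum_mul]
    refine Finset.sum_congr rfl fun n _ => ?_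
    rw [evalOne_single, mul_assoc]
    rfl
  have hrel : mk (fun n => g (.inl n)) * P + mk (fun n => g (.inr n)) * Q = 0 := by
    refine eq_zero_of_evalOne_eq_zero hτ hli
      (Subring.add_mem _ (Subring.mul_mem _ (hmk _) hP) (Subring.mul_mem _ (hmk _) hQ)) ?_
    rw [map_add, hev, hev]
    exact hg
  refine ⟨mk fun n => g (.inl n), hmk _, -mk fun n => g (.inr n), Subring.neg_mem _ (hmk _),
    fun h0 => ?_, ?_⟩
  -- If A = 0 then B Q = 0, so B = 0 as well, against the nontriviality of the linear relation.
  · rw [h0, zero_mul, zero_add] at hrel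
    have h1 : mk (fun n => g (.inr n)) = 0 := by
      have h2 := congrArg evalOne hrel
      rw [map_mul, map_zero, mul_eq_zero] at h2
      refine eq_zero_of_evalOne_eq_zero hτ hli (hmk _) (h2.resolve_right fun h => hQ0 ?_)
      exact eq_zero_of_evalOne_eq_zero hτ hli hQ h
    rcases i with i | i
    · exact hi (congrFun (hmk0 _ h0) i)
    · exact hi (congrFun (hmk0 _ h1) i)
  · rw [neg_mul]
    exact eq_neg_of_add_eq_zero_left hrel

/-- The division ring of fractions of the skew Laurent polynomial ring lies both in `D` and in the
division ring of Laurent series over `D`. -/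
theorem exists_fraction_field
    (hτ : ∀ x ∈ E, ∀ n : ℤ, ((τ ^ n : Dˣ) : D) * x * ((τ ^ (-n) : Dˣ) : D) ∈ E)
    (hli : LinearIndependent E fun n : ℤ => ((τ ^ n : Dˣ) : D)) :
    ∃ (A : Type u) (_ : DivisionRing A) (p : A →+* D) (q : A →+* HahnSeries ℤ D),
      ∀ n x, IsHomogeneous E τ n x → ∃ a, p a = x ∧ q a = HahnSeries.single n x := by
  classical
  let A := skewLaurent hτ
  let p₀ : A →+* D := evalOne.comp A.subtype
  let q₀ : A →+* HahnSeries ℤ D := toLaurentSeries.comp A.subtype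
  have hp₀ : Function.Injective p₀ := by
    rw [injective_iff_map_eq_zero]
    intro a ha
    exact Subtype.ext (eq_zero_of_evalOne_eq_zero hτ hli a.2 ha)
  have hq₀ : ∀ a : A, a ≠ 0 → q₀ a ≠ 0 := by
    intro a ha h0
    refine ha (Subtype.ext ?_)
    rw [ZeroMemClass.coe_zero, ← AddMonoidAlgebra.coeff_eq_zero]
    ext i
    rw [← coeff_toLaurentSeries, Finsupp.zero_apply]
    exact (congrArg (fun y => y.coeff i) h0).trans HahnSeries.coeff_zero
  have : NoZeroDivisors A := hp₀.noZeroDivisors p₀ (map_zero _) (map_mul _)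
  have : Nontrivial A := p₀.domain_nontrivial
  obtain ⟨hO⟩ := (OreLocalization.nonempty_oreSet_iff_of_noZeroDivisors
    (S := nonZeroDivisors A)).2 fun r s => by
      obtain ⟨a, ha, b, hb, ha0, h⟩ := exists_common_multiple hτ hli r.2 (s : A).2
        (fun h => nonZeroDivisors.ne_zero s.2 (Subtype.ext h))
      exact ⟨⟨b, hb⟩, ⟨⟨a, ha⟩, mem_nonZeroDivisors_of_ne_zero
        fun h => ha0 (congrArg Subtype.val h)⟩, Subtype.ext h⟩
  have hpu : ∀ s : nonZeroDivisors A, IsUnit (p₀ s) := fun s =>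
    isUnit_iff_ne_zero.2 ((map_ne_zero_iff p₀ hp₀).2 (nonZeroDivisors.ne_zero s.2))
  have hqu : ∀ s : nonZeroDivisors A, IsUnit (q₀ s) := fun s =>
    HahnSeries.isUnit_of_ne_zero (hq₀ _ (nonZeroDivisors.ne_zero s.2))
  let fp : nonZeroDivisors A →* Dˣ :=
    IsUnit.liftRight ((p₀ : A →* D).comp (nonZeroDivisors A).subtype) hpu
  let fq : nonZeroDivisors A →* (HahnSeries ℤ D)ˣ :=
    IsUnit.liftRight ((q₀ : A →* HahnSeries ℤ D).comp (nonZeroDivisors A).subtype) hqu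
  refine ⟨OreLocalization (nonZeroDivisors A) A, inferInstance,
    OreLocalization.universalHom p₀ fp fun s => (IsUnit.coe_liftRight
      ((p₀ : A →* D).comp (nonZeroDivisors A).subtype) hpu s).symm,
    OreLocalization.universalHom q₀ fq fun s => (IsUnit.coe_liftRight
      ((q₀ : A →* HahnSeries ℤ D).comp (nonZeroDivisors A).subtype) hqu s).symm, fun n x hx => ?_⟩
  have hm : AddMonoidAlgebra.single n x ∈ A := by
    intro m
    rw [AddMonoidAlgebra.coeff_single, Finsupp.single_apply]
    split_ifs with h
    · rwa [← h]
    · unfold IsHomogeneous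
      simp
  refine ⟨OreLocalization.numeratorHom ⟨_, hm⟩, ?_, ?_⟩
  · exact (OreLocalization.universalHom_commutes p₀ fp _).trans (evalOne_single n x)
  · exact (OreLocalization.universalHom_commutes q₀ fq _).trans (toLaurentSeries_single n x)

end SkewLaurent

/-! ### Laurent expansions from Hughes-freeness -/

section HughesFree

variable {F G D : Type u} [DivisionRing F] [Group G] [DivisionRing D]

theorem IsHughesFree.exists_expansions {ι : MonoidAlgebra F G →+* D} (hD : IsHughesFree ι)
    {L : Subgroup G} {φ : G → ℤ} (hL : IsGrading L φ) :
    ∃ (A : Type u) (_ : DivisionRing A) (p : A →+* D) (q : A →+* HahnSeries ℤ D),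
      ∀ (c : F) (g : G), g ∈ L → ∃ a, p a = ι (MonoidAlgebra.single g c) ∧
        q a = HahnSeries.single (φ g) (ι (MonoidAlgebra.single g c)) := by
  let f : L →* Multiplicative ℤ :=
    { toFun := fun g => Multiplicative.ofAdd (φ g)
      map_one' := by simpa using hL.map_one
      map_mul' := fun a b => by
        rw [← ofAdd_add, ← hL.map_mul _ a.2 _ b.2]
        rfl }
  obtain ⟨t, ht, ht1⟩ := hL.surj
  have hft : ∀ n : ℤ, f (⟨t, ht⟩ ^ n) = Multiplicative.ofAdd n := by
    intro n
    rw [map_zpow]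
    change Multiplicative.ofAdd (φ t) ^ n = _
    rw [ht1, ← ofAdd_zsmul]
    simp
  have hf : Function.Surjective f := fun n => ⟨_, hft n.toAdd⟩
  let u : G →* Dˣ := (monomialUnit ι).comp (MonoidHom.inr Fˣ G)
  have hu : ∀ g, (u g : D) = ι (MonoidAlgebra.single g 1) := fun g => rfl
  have hker : ∀ g, g ∈ f.ker.map L.subtype ↔ g ∈ L ∧ φ g = 0 := by
    intro g
    constructor
    · rintro ⟨g, hg, rfl⟩
      exact ⟨g.2, hg⟩
    · rintro ⟨hg, h⟩
      exact ⟨⟨g, hg⟩, h, rfl⟩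
  have hτ : ∀ x ∈ divisionClosure ι (f.ker.map L.subtype), ∀ n : ℤ,
      ((u t ^ n : Dˣ) : D) * x * ((u t ^ (-n) : Dˣ) : D) ∈
        divisionClosure ι (f.ker.map L.subtype) := by
    intro x hx n
    induction hx using Subfield.closure_induction with
    | mem x hx =>
      obtain ⟨c, g, hg, rfl⟩ := hx
      refine Subfield.subset_closure ⟨c, t ^ n * g * t ^ (-n), ?_, ?_⟩
      · have := (f.normal_ker).conj_mem
        obtain ⟨g, hg, rfl⟩ := hg
        refine ⟨_, (f.normal_ker).conj_mem g hg (⟨t, ht⟩ ^ n), ?_⟩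
        simp
      · rw [← map_zpow, ← map_zpow, hu, hu, ← map_mul, ← map_mul,
          MonoidAlgebra.single_mul_single, MonoidAlgebra.single_mul_single, mul_one, one_mul]
    | one =>
      rw [mul_one, ← Units.val_mul, ← zpow_add]
      simp
    | add x y _ _ hx hy =>
      rw [mul_add, add_mul]
      exact Subfield.add_mem _ hx hy
    | neg x _ hx =>
      rw [mul_neg, neg_mul]
      exact Subfield.neg_mem _ hx
    | inv x _ hx =>
      have := Subfield.inv_mem _ hx
      rw [mul_inv_rev, mul_inv_rev, ← mul_assoc, ← Units.val_inv_eq_inv_val,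
        ← Units.val_inv_eq_inv_val, ← zpow_neg, ← zpow_neg, neg_neg] at this
      exact this
    | mul x y _ _ hx hy =>
      have := Subfield.mul_mem _ hx hy
      convert this using 1
      simp only [mul_assoc]
      rw [zpow_neg, Units.inv_mul_cancel_left]
  have hli : LinearIndependent (divisionClosure ι (f.ker.map L.subtype))
      fun n : ℤ => ((u t ^ n : Dˣ) : D) := by
    rw [linearIndependent_iff_finset_linearIndependent]
    intro s
    have := hD.linearIndependent L hL.fg f hf s.card (fun i => ⟨t, ht⟩ ^ ((s.equivFin.symm i : s) : ℤ))
      (fun i j h => by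
        simp only [hft] at h
        exact s.equivFin.symm.injective (Subtype.ext (Multiplicative.ofAdd.injective h)))
    have h2 := this.comp s.equivFin s.equivFin.injective
    convert h2 using 1
    funext i
    simp only [Function.comp, Equiv.symm_apply_apply]
    rw [← map_zpow, hu]
    rfl
  obtain ⟨A, hA, p, q, h⟩ := exists_fraction_field hτ hli
  -- The element g t^(−φ(g)) lies in the kernel of the grading, so c g is homogeneous of degree
  -- φ(g).
  refine ⟨A, hA, p, q, fun c g hg => h _ _ (Subfield.subset_closure ⟨c, g * t ^ (-φ g), ?_, ?_⟩)⟩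
  · rw [hker]
    refine ⟨L.mul_mem hg (L.zpow_mem ht _), ?_⟩
    have := hft (-φ g)
    have h2 : φ (t ^ (-φ g)) = -φ g := this
    rw [hL.map_mul _ hg _ (L.zpow_mem ht _), h2, add_neg_cancel]
  · rw [← map_zpow, hu, ← map_mul, MonoidAlgebra.single_mul_single, mul_one]

end HughesFree

/-! ### Permutation matrices and ranks -/

section MatrixExpansions

theorem Matrix.isUnit_of_isRightRegular {κ A : Type*} [Fintype κ] [DecidableEq κ] [DivisionRing A]
    {b : Matrix κ κ A} (hb : IsRightRegular b) : IsUnit b := by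
  let f : Matrix κ κ A →ₗ[A] Matrix κ κ A :=
    { toFun := fun x => x * b
      map_add' := fun x y => add_mul x y b
      map_smul' := fun a x => Matrix.smul_mul a x b }
  have hf : Function.Injective f := hb
  obtain ⟨c, hc⟩ := LinearMap.injective_iff_surjective.1 hf 1
  have hc' : c * b = 1 := hc
  refine ⟨⟨b, c, hb ?_, hc'⟩, rfl⟩
  change b * c * b = 1 * b
  rw [mul_assoc, hc', mul_one, one_mul]

variable {κ R : Type*} [Fintype κ] [Ring R]

theorem HahnSeries.coeff_mul_of_subset {x y : HahnSeries ℤ R} {s t : Set ℤ} (hs : s.IsPWO)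
    (ht : t.IsPWO) (hxs : x.support ⊆ s) (hyt : y.support ⊆ t) (a : ℤ) :
    (x * y).coeff a = ∑ ij ∈ Finset.antidiagonal hs ht a, x.coeff ij.1 * y.coeff ij.2 := by
  rw [HahnSeries.coeff_mul]
  refine Finset.sum_subset (fun ij h => ?_) fun ij h h' => ?_
  · obtain ⟨h1, h2, h3⟩ := Finset.mem_antidiagonal.1 h
    exact Finset.mem_antidiagonal.2 ⟨hxs h1, hyt h2, h3⟩
  · by_contra h0
    refine h' (Finset.mem_antidiagonal.2 ⟨left_ne_zero_of_mul h0, right_ne_zero_of_mul h0,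
      (Finset.mem_antidiagonal.1 h).2.2⟩)

theorem Matrix.isPWO_iUnion_support (M : Matrix κ κ (HahnSeries ℤ R)) :
    (⋃ i ∈ (Finset.univ : Finset (κ × κ)), (M i.1 i.2).support).IsPWO :=
  (Finset.isPWO_bUnion _).2 fun i _ => (M i.1 i.2).isPWO_support

variable [DecidableEq κ]

/-- A matrix of Laurent series as a Laurent series of matrices. -/
def matrixToHahnSeries : Matrix κ κ (HahnSeries ℤ R) →+* HahnSeries ℤ (Matrix κ κ R) where
  toFun M :=
    { coeff := fun n => M.map fun y => y.coeff n
      isPWO_support' := M.isPWO_iUnion_support.mono fun n hn => by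
        by_contra h
        refine hn (Matrix.ext fun i j => ?_)
        by_contra h'
        exact h (Set.mem_biUnion (Finset.mem_univ (i, j)) h') }
  map_one' := by
    ext n i j
    by_cases h : n = 0 <;> by_cases hij : i = j <;>
      simp [HahnSeries.coeff_one, h, hij]
  map_zero' := by
    ext n i j
    simp
  map_add' M N := by
    ext n i j
    simp
  map_mul' M N := by
    ext n i j
    rw [HahnSeries.coeff_mul_of_subset M.isPWO_iUnion_support N.isPWO_iUnion_support, Matrix.sum_apply]
    · simp only [Matrix.map_apply, Matrix.mul_apply, HahnSeries.coeff_sum]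
      rw [Finset.sum_comm]
      refine Finset.sum_congr rfl fun k _ => ?_
      exact HahnSeries.coeff_mul_of_subset _ _
        (Set.subset_biUnion_of_mem (u := fun i : κ × κ => (M i.1 i.2).support)
          (Finset.mem_univ (i, k)))
        (Set.subset_biUnion_of_mem (u := fun i : κ × κ => (N i.1 i.2).support)
          (Finset.mem_univ (k, j))) _
    · intro n hn
      by_contra h
      refine hn (Matrix.ext fun i j => ?_)
      by_contra h'
      exact h (Set.mem_biUnion (Finset.mem_univ (i, j)) h')
    · intro n hn
      by_contra h
      refine hn (Matrix.ext fun i j => ?_)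
      by_contra h'
      exact h (Set.mem_biUnion (Finset.mem_univ (i, j)) h')

theorem matrixToHahnSeries_coeff (M : Matrix κ κ (HahnSeries ℤ R)) (n : ℤ) :
    (matrixToHahnSeries M).coeff n = M.map fun y => y.coeff n := rfl

theorem matrixToHahnSeries_injective :
    Function.Injective (matrixToHahnSeries (κ := κ) (R := R)) := by
  intro M N h
  ext i j n
  have := congrArg (fun y => y.coeff n i j) h
  exact this

end MatrixExpansions

section PermutationMatrices

variable {F G D κ : Type u} [DivisionRing F] [Group G] [DivisionRing D] [Fintype κ]
  [DecidableEq κ] [MulAction G κ]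

variable (F) in
/-- The ring homomorphism `F[G] → M_κ(F[G])` which maps a group element `g` to `g` times its
permutation matrix. -/
noncomputable def permHom : MonoidAlgebra F G →+* Matrix κ κ (MonoidAlgebra F G) :=
  MonoidAlgebra.liftNCRingHom
    ((Matrix.scalar κ).comp (MonoidAlgebra.singleOneRingHom (R := F) (M := G)))
    { toFun := fun g => Matrix.of fun i j => if g • j = i then MonoidAlgebra.single g 1 else 0
      map_one' := by
        ext1 i j
        simp [Matrix.one_apply, eq_comm, MonoidAlgebra.one_def]
      map_mul' := fun g h => by
        ext1 i j
        simp only [Matrix.of_apply, Matrix.mul_apply, mul_ite, mul_zero]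
        rw [Finset.sum_eq_single (h • j)]
        · simp [mul_smul, MonoidAlgebra.single_mul_single]
        · intro k _ hk
          rw [if_neg (Ne.symm hk)]
        · simp }
    fun c g => by
      change _ * _ = _ * _
      ext1 i j
      simp [Matrix.scalar_apply, Matrix.diagonal_mul, Matrix.mul_diagonal,
        MonoidAlgebra.single_mul_single]

theorem permHom_single (g : G) (c : F) (i j : κ) :
    permHom F (κ := κ) (MonoidAlgebra.single g c) i j =
      if g • j = i then MonoidAlgebra.single g c else 0 := by
  have : permHom F (κ := κ) (MonoidAlgebra.single g c) = _ * _ :=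
    MonoidAlgebra.liftNC_single _ _ _ _
  rw [this]
  simp [Matrix.scalar_apply, Matrix.diagonal_mul, MonoidAlgebra.single_mul_single]

/-- The nonzero entries of the matrix of c g all equal ι(c g), homogeneous of the one degree φ(g).
So matrices over the division ring A of `IsHughesFree.exists_expansions` can serve as B, once
matrices of series are read as series of matrices. -/
theorem IsHughesFree.hasAllExpansions {ι : MonoidAlgebra F G →+* D} (hD : IsHughesFree ι) :
    HasAllExpansions (ι.mapMatrix.comp (permHom F (κ := κ))) := by
  intro L φ hL
  obtain ⟨A, _, p, q, h⟩ := hD.exists_expansions hL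
  refine ⟨Matrix κ κ A, inferInstance, p.mapMatrix, matrixToHahnSeries.comp q.mapMatrix,
    Matrix.map_injective p.injective,
    matrixToHahnSeries_injective.comp (Matrix.map_injective q.injective),
    fun b hb => Matrix.isUnit_of_isRightRegular hb, fun c g hg => ?_⟩
  obtain ⟨a, hp, hq⟩ := h c g hg
  refine ⟨Matrix.of fun i j => if g • j = i then a else 0, ?_, ?_⟩
  · ext1 i j
    simp only [RingHom.mapMatrix_apply, Matrix.map_apply, Matrix.of_apply, RingHom.coe_comp,
      Function.comp, permHom_single]
    split_ifs
    exacts [hp, by simp]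
  · ext n i j
    simp only [RingHom.coe_comp, Function.comp, matrixToHahnSeries_coeff,
      RingHom.mapMatrix_apply, Matrix.map_apply, Matrix.of_apply]
    by_cases hn : n = φ g
    · subst hn
      rw [HahnSeries.coeff_single_same, Matrix.map_apply, permHom_single]
      split_ifs
      · rw [hq, HahnSeries.coeff_single_same]
      · simp
    · rw [HahnSeries.coeff_single_of_ne hn, Matrix.zero_apply]
      split_ifs
      · rw [hq, HahnSeries.coeff_single_of_ne hn]
      · simp

end PermutationMatrices

section Rank

/-- The dimension of the left vector space which is spanned by the rows of a matrix. -/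
noncomputable def rowRank {E : Type*} [DivisionRing E] {m n : Type*} (A : Matrix m n E) : ℕ :=
  Module.finrank E (Submodule.span E (Set.range A.row))

theorem rowRank_mul_le {E l m n : Type*} [DivisionRing E] [Fintype m] [Fintype n]
    (X : Matrix l m E) (Y : Matrix m n E) : rowRank (X * Y) ≤ Fintype.card m := by
  refine le_trans (Submodule.finrank_mono (Submodule.span_le.2 ?_))
    (finrank_range_le_card (R := E) Y.row)
  rintro _ ⟨i, rfl⟩
  have : (X * Y).row i = ∑ j, X i j • Y.row j := by
    ext k
    simp [Matrix.mul_apply]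
  rw [this]
  exact Submodule.sum_mem _ fun j _ => Submodule.smul_mem _ _ (Submodule.subset_span ⟨j, rfl⟩)

theorem exists_rank_factorization {E : Type*} [DivisionRing E] {m n : Type*} [Fintype n]
    (A : Matrix m n E) :
    ∃ (X : Matrix m (Fin (rowRank A)) E) (Y : Matrix (Fin (rowRank A)) n E), A = X * Y := by
  let b := Module.finBasis E (Submodule.span E (Set.range A.row))
  refine ⟨Matrix.of fun i j => b.repr ⟨A.row i, Submodule.subset_span ⟨i, rfl⟩⟩ j,
    Matrix.of fun j k => (b j : n → E) k, ?_⟩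
  ext i k
  have := congrArg (fun v : Submodule.span E (Set.range A.row) => (v : n → E) k)
    (b.sum_repr ⟨A.row i, Submodule.subset_span ⟨i, rfl⟩⟩)
  simp only [Submodule.coe_sum, Submodule.coe_smul, Finset.sum_apply, Pi.smul_apply,
    smul_eq_mul] at this
  exact this.symm

theorem rowRank_reindex {E m n m' n' : Type*} [DivisionRing E] (e : m' ≃ m) (f : n' ≃ n)
    (A : Matrix m n E) : rowRank (A.submatrix e f) = rowRank A := by
  have h : Submodule.span E (Set.range (A.submatrix e f).row) =
      (Submodule.span E (Set.range A.row)).map (LinearEquiv.funCongrLeft E E f).toLinearMap := by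
    rw [Submodule.map_span, ← Set.range_comp]
    congr 1
    refine (e.surjective.range_comp _).symm.trans ?_ |>.symm
    rfl
  unfold rowRank
  rw [h]
  exact LinearEquiv.finrank_map_eq _ _

theorem Matrix.comp_mul {R l m n κ : Type*} [Ring R] [Fintype m] [Fintype κ]
    (X : Matrix l m (Matrix κ κ R)) (Y : Matrix m n (Matrix κ κ R)) :
    Matrix.comp _ _ _ _ _ (X * Y) =
      Matrix.comp _ _ _ _ _ X * Matrix.comp _ _ _ _ _ Y := by
  ext ⟨i, k⟩ ⟨j, k'⟩
  simp [Matrix.mul_apply, Matrix.sum_apply, Fintype.sum_prod_type]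

variable {F G D κ : Type u} [DivisionRing F] [Group G] [DivisionRing D] [Fintype κ]
  [DecidableEq κ] [MulAction G κ]

theorem rowRank_permHom_le_of_hughesFree [Nonempty κ] (hG : IsLocallyIndicable G)
    {ι : MonoidAlgebra F G →+* D}
    (hD : IsHughesFree ι) (hU : IsUniversalDivisionRing ι) {m n : ℕ}
    (A : Matrix (Fin m) (Fin n) (MonoidAlgebra F G)) :
    rowRank (Matrix.comp _ _ _ _ _ (A.map (ι.mapMatrix.comp (permHom F (κ := κ))))) ≤
      Fintype.card κ * skewRank (A.map ι) := by
  set δ := ι.mapMatrix.comp (permHom F (κ := κ))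
  obtain ⟨T, hT, hinv⟩ := exists_division_subring hG (hD.hasAllExpansions (κ := κ))
  let _ : DivisionRing T := DivisionRing.ofIsUnitOrEqZero fun a => by
    by_cases ha : a = 0
    · exact .inr ha
    · obtain ⟨y, hy, h1, h2⟩ := hinv a a.2 fun h => ha (Subtype.ext h)
      exact .inl ⟨⟨a, ⟨y, hy⟩, Subtype.ext h1, Subtype.ext h2⟩, rfl⟩
  let δ' : MonoidAlgebra F G →+* T := δ.codRestrict T hT
  obtain ⟨X, Y, h⟩ := exists_rank_factorization (A.map δ')
  have h' : A.map δ = X.map T.subtype * Y.map T.subtype := by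
    rw [← Matrix.map_mul, ← h, Matrix.map_map]
    rfl
  rw [h', Matrix.comp_mul]
  refine (rowRank_mul_le _ _).trans ?_
  rw [Fintype.card_prod, Fintype.card_fin, mul_comm]
  -- Universality is applied to the division subring of M_κ(D) that contains the image of δ.
  exact Nat.mul_le_mul_left _ (hU.rank_le T δ' m n A)

theorem rowRank_permHom_augmentation_le [Nonempty κ] (hG : IsLocallyIndicable G)
    {ι : MonoidAlgebra F G →+* D}
    (hD : IsHughesFree ι) (hU : IsUniversalDivisionRing ι) {m n : ℕ}
    (A : Matrix (Fin m) (Fin n) (MonoidAlgebra F G)) :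
    rowRank (Matrix.comp _ _ _ _ _
      (A.map ((augmentation F G).mapMatrix.comp (permHom F (κ := κ))))) ≤
      Fintype.card κ * skewRank (A.map ι) := by
  refine le_trans ?_ (rowRank_permHom_le_of_hughesFree (κ := κ) hG hD hU A)
  let e : ∀ m, Fin (Fintype.card (Fin m × κ)) ≃ Fin m × κ := fun m => (Fintype.equivFin _).symm
  -- Universality is applied to the augmentation and to the flattened matrix over F[G], not to A
  -- itself.
  have h := hU.rank_le F (augmentation F G) _ _
    ((Matrix.comp _ _ _ _ _ (A.map (permHom F (κ := κ)))).submatrix (e m) (e n))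
  rw [← Matrix.submatrix_map, ← Matrix.submatrix_map] at h
  have h1 := rowRank_reindex (e m) (e n)
    ((Matrix.comp _ _ _ _ _ (A.map (permHom F (κ := κ)))).map (augmentation F G))
  have h2 := rowRank_reindex (e m) (e n)
    ((Matrix.comp _ _ _ _ _ (A.map (permHom F (κ := κ)))).map ι)
  exact (h1.symm.le.trans h).trans h2.le

end Rank

/-! ### Additive functors and ranks -/

section FunctorRank

variable {R E : Type u} [Ring R] [DivisionRing E] (T : ModuleCat.{u} R ⥤ ModuleCat.{u} E)

/-- The rank of the linear map which a functor to vector spaces attaches to a morphism. -/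
noncomputable def functorRank {M N : ModuleCat.{u} R} (f : M ⟶ N) : ℕ :=
  Module.finrank E (LinearMap.range (T.map f).hom)

/-- The coordinate projections of a free module. -/
def freeProj {n : ℕ} (i : Fin n) : ModuleCat.of R (Fin n → R) ⟶ ModuleCat.of R R :=
  ModuleCat.ofHom (LinearMap.proj i)

/-- The coordinate inclusions of a free module. -/
def freeIncl {n : ℕ} (i : Fin n) : ModuleCat.of R R ⟶ ModuleCat.of R (Fin n → R) :=
  ModuleCat.ofHom (LinearMap.single R (fun _ => R) i)

/-- Right multiplication by `x`. -/
def rightMul (x : R) : ModuleCat.of R R ⟶ ModuleCat.of R R :=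
  ModuleCat.ofHom (LinearMap.toSpanSingleton R R x)

theorem freeIncl_freeProj {n : ℕ} (i : Fin n) :
    freeIncl (R := R) i ≫ freeProj i = 𝟙 _ := by
  ext
  simp [freeIncl, freeProj]

theorem freeIncl_freeProj_of_ne {n : ℕ} {i j : Fin n} (h : i ≠ j) :
    freeIncl (R := R) i ≫ freeProj j = 0 := by
  ext
  simp [freeIncl, freeProj, h.symm]

theorem sum_freeProj_freeIncl (n : ℕ) :
    ∑ i : Fin n, freeProj (R := R) i ≫ freeIncl i = 𝟙 _ := by
  ext x
  simp [freeProj, freeIncl, ModuleCat.hom_sum, Pi.single_apply]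

/-- The matrix of a linear map between free modules of finite rank: the rows are the images of
the basis vectors. -/
def freeMatrix {m n : ℕ} (f : ModuleCat.of R (Fin m → R) ⟶ ModuleCat.of R (Fin n → R)) :
    Matrix (Fin m) (Fin n) R :=
  Matrix.of fun i j => f.hom (Pi.single i 1) j

theorem freeIncl_comp_freeProj {m n : ℕ}
    (f : ModuleCat.of R (Fin m → R) ⟶ ModuleCat.of R (Fin n → R)) (i : Fin m) (j : Fin n) :
    freeIncl i ≫ f ≫ freeProj j = rightMul (freeMatrix f i j) := by
  ext
  simp [freeIncl, freeProj, rightMul, freeMatrix]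

variable {T} [T.Additive] {κ : Type*} [Fintype κ]

/-- The values of an additive functor on free modules. -/
noncomputable def functorFreeEquiv (θ : T.obj (ModuleCat.of R R) ≃ₗ[E] (κ → E)) (n : ℕ) :
    T.obj (ModuleCat.of R (Fin n → R)) ≃ₗ[E] (Fin n × κ → E) :=
  LinearEquiv.ofLinearMap
    (LinearMap.pi fun ik : Fin n × κ =>
      (LinearMap.proj ik.2).comp (θ.toLinearMap.comp (T.map (freeProj ik.1)).hom))
    (∑ i, (T.map (freeIncl i)).hom.comp (θ.symm.toLinearMap.comp
      (LinearMap.funLeft E E fun k => (i, k))))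
    (by
      refine LinearMap.ext fun v => funext fun ⟨j, k⟩ => ?_
      simp only [LinearMap.comp_apply, LinearMap.pi_apply, LinearMap.sum_apply, map_sum,
        LinearMap.proj_apply, LinearEquiv.coe_coe, LinearMap.id_apply]
      rw [Finset.sum_eq_single j]
      · rw [← LinearMap.comp_apply, ← ModuleCat.hom_comp, ← T.map_comp, freeIncl_freeProj,
          T.map_id]
        simp [LinearMap.funLeft_apply]
      · intro i _ hi
        rw [← LinearMap.comp_apply (T.map (freeProj j)).hom, ← ModuleCat.hom_comp, ← T.map_comp,
          freeIncl_freeProj_of_ne hi, T.map_zero]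
        simp
      · simp)
    (by
      refine LinearMap.ext fun t => ?_
      simp only [LinearMap.comp_apply, LinearMap.sum_apply, LinearMap.id_apply,
        LinearEquiv.coe_coe]
      have h : ∀ i : Fin n, θ.symm (LinearMap.funLeft E E (fun k => (i, k))
          (LinearMap.pi (fun ik : Fin n × κ => (LinearMap.proj ik.2).comp
            (θ.toLinearMap.comp (T.map (freeProj ik.1)).hom)) t)) =
            (T.map (freeProj i)).hom t := by
        intro i
        rw [LinearEquiv.symm_apply_eq]
        rfl
      simp only [h]
      have h2 := congrArg (fun f => (T.map f).hom t) (sum_freeProj_freeIncl (R := R) n)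
      simpa [Functor.map_sum] using h2)

omit [Fintype κ] in
theorem functorFreeEquiv_apply (θ : T.obj (ModuleCat.of R R) ≃ₗ[E] (κ → E)) (n : ℕ)
    (t : T.obj (ModuleCat.of R (Fin n → R))) (i : Fin n) (k : κ) :
    functorFreeEquiv θ n t (i, k) = θ ((T.map (freeProj i)).hom t) k := rfl

theorem functorFreeEquiv_map {θ : T.obj (ModuleCat.of R R) ≃ₗ[E] (κ → E)}
    {ρ : R → Matrix κ κ E}
    (hθ : ∀ x t, θ ((T.map (rightMul x)).hom t) = Matrix.vecMul (θ t) (ρ x)) {m n : ℕ}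
    (f : ModuleCat.of R (Fin m → R) ⟶ ModuleCat.of R (Fin n → R))
    (t : T.obj (ModuleCat.of R (Fin m → R))) :
    functorFreeEquiv θ n ((T.map f).hom t) =
      Matrix.vecMul (functorFreeEquiv θ m t)
        (Matrix.comp _ _ _ _ _ ((freeMatrix f).map ρ)) := by
  ext ⟨j, k⟩
  rw [functorFreeEquiv_apply]
  have h1 : f ≫ freeProj j = ∑ i, freeProj i ≫ rightMul (freeMatrix f i j) := by
    rw [← Category.id_comp (f ≫ freeProj j), ← sum_freeProj_freeIncl, Preadditive.sum_comp]
    simp only [Category.assoc, freeIncl_comp_freeProj]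
  have h2 : (T.map (freeProj j)).hom ((T.map f).hom t) =
      ∑ i, (T.map (rightMul (freeMatrix f i j))).hom ((T.map (freeProj i)).hom t) := by
    rw [← LinearMap.comp_apply, ← ModuleCat.hom_comp, ← T.map_comp, h1, Functor.map_sum]
    simp
  rw [h2, map_sum, Finset.sum_apply]
  simp only [hθ]
  simp only [Matrix.vecMul, dotProduct, Fintype.sum_prod_type, Matrix.comp_apply,
    Matrix.map_apply, functorFreeEquiv_apply]

theorem functorRank_free {θ : T.obj (ModuleCat.of R R) ≃ₗ[E] (κ → E)}
    {ρ : R → Matrix κ κ E}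
    (hθ : ∀ x t, θ ((T.map (rightMul x)).hom t) = Matrix.vecMul (θ t) (ρ x)) {m n : ℕ}
    (f : ModuleCat.of R (Fin m → R) ⟶ ModuleCat.of R (Fin n → R)) :
    functorRank T f = rowRank (Matrix.comp _ _ _ _ _ ((freeMatrix f).map ρ)) := by
  classical
  set A := Matrix.comp _ _ _ _ _ ((freeMatrix f).map ρ) with hA
  have h : (LinearMap.range (T.map f).hom).map (functorFreeEquiv θ n).toLinearMap =
      Submodule.span E (Set.range A.row) := by
    refine le_antisymm ?_ (Submodule.span_le.2 ?_)
    · rintro _ ⟨_, ⟨t, rfl⟩, rfl⟩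
      change functorFreeEquiv θ n ((T.map f).hom t) ∈ _
      rw [functorFreeEquiv_map hθ, Matrix.vecMul_eq_sum]
      exact Submodule.sum_mem _ fun i _ =>
        Submodule.smul_mem _ _ (Submodule.subset_span ⟨i, rfl⟩)
    · rintro _ ⟨i, rfl⟩
      refine ⟨_, ⟨(functorFreeEquiv θ m).symm (Pi.single i 1), rfl⟩, ?_⟩
      change functorFreeEquiv θ n ((T.map f).hom _) = _
      rw [functorFreeEquiv_map hθ, LinearEquiv.apply_symm_apply, Matrix.single_one_vecMul]
  unfold functorRank rowRank
  rw [← h]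
  exact (LinearEquiv.finrank_map_eq _ _).symm

omit [T.Additive] in
theorem functorRank_comp_of_split {M M' N N' : ModuleCat.{u} R} {p : M' ⟶ M} {s : M ⟶ M'}
    (h : s ≫ p = 𝟙 M) {p' : N' ⟶ N} {s' : N ⟶ N'} (h' : s' ≫ p' = 𝟙 N) (f : M ⟶ N) :
    functorRank T (p ≫ f ≫ s') = functorRank T f := by
  have hs : Function.Injective (T.map s').hom := by
    have : Function.LeftInverse (T.map p').hom (T.map s').hom := fun t => by
      rw [← LinearMap.comp_apply, ← ModuleCat.hom_comp, ← T.map_comp, h', T.map_id]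
      rfl
    exact this.injective
  have hp : Function.Surjective (T.map p).hom := by
    have : Function.RightInverse (T.map s).hom (T.map p).hom := fun t => by
      rw [← LinearMap.comp_apply, ← ModuleCat.hom_comp, ← T.map_comp, h, T.map_id]
      rfl
    exact this.surjective
  unfold functorRank
  rw [T.map_comp, T.map_comp, ModuleCat.hom_comp, ModuleCat.hom_comp, LinearMap.range_comp,
    LinearMap.range_eq_top.2 hp, Submodule.map_top, LinearMap.range_comp]
  exact (Submodule.equivMapOfInjective _ hs _).finrank_eq.symm

theorem exists_free_split (M : ModuleCat.{u} R) [Module.Finite R M] [Projective M] :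
    ∃ (n : ℕ) (p : ModuleCat.of R (Fin n → R) ⟶ M) (s : M ⟶ ModuleCat.of R (Fin n → R)),
      s ≫ p = 𝟙 M := by
  obtain ⟨n, f, hf⟩ := Module.Finite.exists_fin' R M
  have : Epi (ModuleCat.ofHom f) := (ModuleCat.epi_iff_surjective _).2 hf
  exact ⟨n, ModuleCat.ofHom f, Projective.factorThru (𝟙 M) (ModuleCat.ofHom f),
    Projective.factorThru_comp _ _⟩

theorem finite_functor_obj (θ : T.obj (ModuleCat.of R R) ≃ₗ[E] (κ → E)) (M : ModuleCat.{u} R)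
    [Module.Finite R M] [Projective M] : Module.Finite E (T.obj M) := by
  obtain ⟨n, p, s, h⟩ := exists_free_split M
  have := Module.Finite.equiv (functorFreeEquiv θ n).symm
  refine Module.Finite.of_surjective (T.map p).hom ?_
  have : Function.RightInverse (T.map s).hom (T.map p).hom := fun t => by
    rw [← LinearMap.comp_apply, ← ModuleCat.hom_comp, ← T.map_comp, h, T.map_id]
    rfl
  exact this.surjective

omit [T.Additive] in
theorem functorRank_id (M : ModuleCat.{u} R) :
    functorRank T (𝟙 M) = Module.finrank E (T.obj M) := by
  unfold functorRank
  rw [T.map_id, ModuleCat.hom_id, LinearMap.range_id, finrank_top]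

/-- The images of an idempotent and of its complement split the value of T on the free module. -/
theorem functorRank_complement (θ : T.obj (ModuleCat.of R R) ≃ₗ[E] (κ → E)) {n : ℕ}
    {M : ModuleCat.{u} R} {p : ModuleCat.of R (Fin n → R) ⟶ M}
    {s : M ⟶ ModuleCat.of R (Fin n → R)} (h : s ≫ p = 𝟙 M) :
    functorRank T (𝟙 _ - p ≫ s) + Module.finrank E (T.obj M) = n * Fintype.card κ := by
  have hfin := Module.Finite.equiv (functorFreeEquiv θ n).symm
  have h1 : functorRank T (p ≫ s) = Module.finrank E (T.obj M) := by
    rw [← functorRank_id]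
    simpa using functorRank_comp_of_split (T := T) h h (𝟙 M)
  have hr : LinearMap.range (T.map (𝟙 _ - p ≫ s)).hom = LinearMap.ker (T.map (p ≫ s)).hom := by
    have e1 : ∀ t, (T.map (𝟙 (ModuleCat.of R (Fin n → R)) - p ≫ s)).hom t =
        t - (T.map (p ≫ s)).hom t := fun t => by
      rw [Functor.map_sub, T.map_id]
      rfl
    have e2 : ∀ t, (T.map (p ≫ s)).hom ((T.map (p ≫ s)).hom t) = (T.map (p ≫ s)).hom t :=
      fun t => by
        rw [← LinearMap.comp_apply, ← ModuleCat.hom_comp, ← T.map_comp, Category.assoc,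
          reassoc_of% h]
    ext t
    constructor
    · rintro ⟨t, rfl⟩
      rw [LinearMap.mem_ker, e1, map_sub, e2, sub_self]
    · intro ht
      exact ⟨t, by rw [e1, LinearMap.mem_ker.1 ht, sub_zero]⟩
  have h2 := LinearMap.finrank_range_add_finrank_ker (T.map (p ≫ s)).hom
  rw [← hr, (functorFreeEquiv θ n).finrank_eq, Module.finrank_fintype_fun_eq_card,
    Fintype.card_prod, Fintype.card_fin] at h2
  rw [← h1, add_comm]
  exact h2

end FunctorRank

section Comparison

variable {R E E' : Type u} [Ring R] [DivisionRing E] [DivisionRing E']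
  {T : ModuleCat.{u} R ⥤ ModuleCat.{u} E} [T.Additive]
  {T' : ModuleCat.{u} R ⥤ ModuleCat.{u} E'} [T'.Additive]
  {κ : Type*} [Fintype κ]

omit [T.Additive] [T'.Additive] in
theorem functorRank_le_of_free {k : ℕ}
    (h : ∀ (m n : ℕ) (f : ModuleCat.of R (Fin m → R) ⟶ ModuleCat.of R (Fin n → R)),
      functorRank T' f ≤ k * functorRank T f)
    {M N : ModuleCat.{u} R} [Module.Finite R M] [Projective M] [Module.Finite R N] [Projective N]
    (f : M ⟶ N) : functorRank T' f ≤ k * functorRank T f := by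
  obtain ⟨m, p, s, hps⟩ := exists_free_split M
  obtain ⟨n, p', s', hps'⟩ := exists_free_split N
  have := h m n (p ≫ f ≫ s')
  rwa [functorRank_comp_of_split hps hps', functorRank_comp_of_split hps hps'] at this

/-- The rank inequality holds for both the idempotent defining M and its complement. The two ranks
add up to n|κ| on either side, so both inequalities are equalities. -/
theorem finrank_functor_obj_eq (θ : T.obj (ModuleCat.of R R) ≃ₗ[E] (Unit → E))
    (θ' : T'.obj (ModuleCat.of R R) ≃ₗ[E'] (κ → E'))
    (h : ∀ (m n : ℕ) (f : ModuleCat.of R (Fin m → R) ⟶ ModuleCat.of R (Fin n → R)),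
      functorRank T' f ≤ Fintype.card κ * functorRank T f)
    (M : ModuleCat.{u} R) [Module.Finite R M] [Projective M] :
    Module.finrank E' (T'.obj M) = Fintype.card κ * Module.finrank E (T.obj M) := by
  obtain ⟨n, p, s, hps⟩ := exists_free_split M
  have h1 := functorRank_complement θ hps
  have h2 := functorRank_complement θ' hps
  have h3 := h n n (𝟙 _ - p ≫ s)
  have h4 := functorRank_le_of_free h (𝟙 M)
  rw [functorRank_id, functorRank_id] at h4
  rw [Fintype.card_unit, mul_one] at h1
  have h5 : Fintype.card κ * functorRank T (𝟙 _ - p ≫ s) +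
      Fintype.card κ * Module.finrank E (T.obj M) = n * Fintype.card κ := by
    rw [← mul_add, h1, mul_comm]
  omega

end Comparison

section Homology

variable {E : Type u} [DivisionRing E]

theorem finrank_homology_shortComplex (S : ShortComplex (ModuleCat.{u} E))
    [Module.Finite E S.X₂] :
    Module.Finite E S.homology ∧ Module.finrank E S.homology +
      Module.finrank E (LinearMap.range S.f.hom) + Module.finrank E (LinearMap.range S.g.hom) =
        Module.finrank E S.X₂ := by
  have e : S.homology ≃ₗ[E] (LinearMap.ker S.g.hom ⧸ LinearMap.range S.moduleCatToCycles) :=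
    S.moduleCatHomologyIso.toLinearEquiv
  refine ⟨Module.Finite.equiv e.symm, ?_⟩
  rw [e.finrank_eq, ← LinearMap.finrank_range_add_finrank_ker S.g.hom]
  have h := Submodule.finrank_quotient_add_finrank (LinearMap.range S.moduleCatToCycles)
  have h2 : Module.finrank E (LinearMap.range S.f.hom) =
      Module.finrank E (LinearMap.range S.moduleCatToCycles) := by
    have : LinearMap.range S.f.hom =
        (LinearMap.range S.moduleCatToCycles).map (LinearMap.ker S.g.hom).subtype := by
      rw [← LinearMap.range_comp]
      rfl
    rw [this]
    exact (Submodule.equivMapOfInjective _ (Submodule.injective_subtype _) _).finrank_eq.symm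
  omega

end Homology

/-! ### Base change of free modules in coordinates -/

section BaseChangeLift

variable {R : Type u} [Ring R] {S : Type v} [Ring S] (φ : R →+* S)

theorem baseChange_mk_mul_tmul {M : Type w} [AddCommGroup M] [Module R M] (s : S) (r : R) (m : M) :
    (Submodule.Quotient.mk ((s * φ r) ⊗ₜ[ℤ] m) : BaseChange φ M) =
      Submodule.Quotient.mk (s ⊗ₜ[ℤ] (r • m)) :=
  (Submodule.Quotient.eq _).2 (Submodule.subset_span ⟨s, r, m, rfl⟩)

/-- The `S`-linear map `S ⊗[R] M → P` induced by an additive map `M → P` that is semilinear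
along `φ`. -/
noncomputable def baseChangeLift {M : Type w} [AddCommGroup M] [Module R M] {P : Type*}
    [AddCommGroup P] [Module S P] (b : M →+ P) (hb : ∀ (r : R) (m : M), b (r • m) = φ r • b m) :
    BaseChange φ M →ₗ[S] P :=
  (baseChangeRel φ M).liftQ
    (TensorProduct.AlgebraTensorModule.lift
      ((LinearMap.toSpanSingleton S (M →ₗ[ℤ] P) b.toIntLinearMap)))
    (Submodule.span_le.2 (by
      rintro _ ⟨s, r, m, rfl⟩
      simp [hb, mul_smul]))

@[simp]
theorem baseChangeLift_mk {M : Type w} [AddCommGroup M] [Module R M] {P : Type*}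
    [AddCommGroup P] [Module S P] (b : M →+ P) (hb : ∀ (r : R) (m : M), b (r • m) = φ r • b m)
    (s : S) (m : M) : baseChangeLift φ b hb (Submodule.Quotient.mk (s ⊗ₜ[ℤ] m)) = s • b m :=
  rfl

end BaseChangeLift

section BaseChangeFree

variable {R S M κ : Type*} [Ring R] [Ring S] [AddCommGroup M] [Module R M] [Fintype κ]
  [DecidableEq κ] (φ : R →+* S)

/-- Coordinates on `S ⊗[R] M` given by a semilinear map `b : M → κ → S` and elements `t c` of `M`
that give the dual basis. -/
noncomputable def baseChangeCoordEquiv (b : M →+ (κ → S)) (t : κ → M)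
    (hb : ∀ (r : R) (m : M), b (r • m) = φ r • b m) (ht : ∀ c, b (t c) = Pi.single c 1)
    (hs : ∀ (s : S) (m : M), (Submodule.Quotient.mk (s ⊗ₜ[ℤ] m) : BaseChange φ M) =
      ∑ c, Submodule.Quotient.mk ((s * b m c) ⊗ₜ[ℤ] t c)) :
    BaseChange φ M ≃ₗ[S] (κ → S) :=
  LinearEquiv.ofLinearMap (baseChangeLift φ b hb)
    (Fintype.linearCombination S fun c => (Submodule.Quotient.mk (1 ⊗ₜ[ℤ] t c) : BaseChange φ M))
    (by
      refine LinearMap.pi_ext' fun c => LinearMap.ext_ring ?_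
      simp [ht])
    (by
      refine baseChange_hom_ext φ fun s m => ?_
      rw [LinearMap.id_apply, hs s m]
      simp [Fintype.linearCombination_apply, ← Submodule.Quotient.mk_smul,
        TensorProduct.smul_tmul', ht, Pi.single_apply])

theorem baseChangeCoordEquiv_map (b : M →+ (κ → S)) (t : κ → M)
    (hb : ∀ (r : R) (m : M), b (r • m) = φ r • b m) (ht : ∀ c, b (t c) = Pi.single c 1)
    (hs : ∀ (s : S) (m : M), (Submodule.Quotient.mk (s ⊗ₜ[ℤ] m) : BaseChange φ M) =
      ∑ c, Submodule.Quotient.mk ((s * b m c) ⊗ₜ[ℤ] t c))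
    (f : M →ₗ[R] M) (A : Matrix κ κ S) (hf : ∀ m, b (f m) = Matrix.vecMul (b m) A)
    (y : BaseChange φ M) :
    baseChangeCoordEquiv φ b t hb ht hs (baseChangeMap φ f y) =
      Matrix.vecMul (baseChangeCoordEquiv φ b t hb ht hs y) A := by
  have h : (baseChangeCoordEquiv φ b t hb ht hs).toLinearMap ∘ₗ baseChangeMap φ f =
      A.vecMulLinear ∘ₗ (baseChangeCoordEquiv φ b t hb ht hs).toLinearMap := by
    refine baseChange_hom_ext φ fun s m => ?_
    have h1 : s • b (f m) = Matrix.vecMul (s • b m) A := by rw [hf, Matrix.smul_vecMul]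
    exact h1
  exact LinearMap.congr_fun h y

end BaseChangeFree

section TypeFree

variable {R S : Type u} [Ring R] [Ring S] (φ : R →+* S)

theorem exists_baseChangeFunctor_self_equiv :
    ∃ θ : (baseChangeFunctor φ).obj (ModuleCat.of R R) ≃ₗ[S] (Unit → S),
      ∀ x t, θ (((baseChangeFunctor φ).map (rightMul x)).hom t) =
        Matrix.vecMul (θ t) (Matrix.scalar Unit (φ x)) := by
  have hs (s : S) (a : R) : (Submodule.Quotient.mk (s ⊗ₜ[ℤ] a) : BaseChange φ R) =
      ∑ c : Unit, Submodule.Quotient.mk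
        ((s * (Pi.constAddMonoidHom Unit S).comp φ.toAddMonoidHom a c) ⊗ₜ[ℤ] (1 : R)) := by
    simpa using (baseChange_mk_mul_tmul φ s a (1 : R)).symm
  exact ⟨baseChangeCoordEquiv φ (M := R) ((Pi.constAddMonoidHom Unit S).comp φ.toAddMonoidHom)
      (fun _ => 1) (fun r a => by ext; simp) (fun c => by ext; simp) hs,
    fun x t => baseChangeCoordEquiv_map φ (M := R) _ (fun _ => 1) _ _ _
      (LinearMap.toSpanSingleton R R x) _
      (fun a => by ext; simp [Matrix.vecMul, dotProduct]) t⟩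

end TypeFree

/-! ### Restriction to a subgroup and the coset representation -/

section Subgroup

variable {F G : Type u} [DivisionRing F] [Group G] (H : Subgroup G)

theorem augmentation_single (g : G) (c : F) :
    augmentation F G (MonoidAlgebra.single g c) = c := by
  simp [augmentation]

variable (F) in
/-- The inclusion `F[H] → F[G]`. -/
noncomputable def subgroupInclusion : MonoidAlgebra F H →+* MonoidAlgebra F G :=
  MonoidAlgebra.mapDomainRingHom F H.subtype

theorem subgroupInclusion_single (h : H) (c : F) :
    subgroupInclusion F H (MonoidAlgebra.single h c) = MonoidAlgebra.single (h : G) c := by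
  simp [subgroupInclusion]

theorem augmentation_comp_subgroupInclusion :
    (augmentation F G).comp (subgroupInclusion F H) = augmentation F H := by
  refine RingHom.coe_addMonoidHom_injective (MonoidAlgebra.addMonoidHom_ext fun h c => ?_)
  simp [subgroupInclusion_single, augmentation_single]

/-- The element `h` of `H` with `g = h r⁻¹`, where `r` is the chosen representative of the left
coset of `g⁻¹`. -/
noncomputable def cosetPart (g : G) : H :=
  ⟨g * Quotient.out ((g⁻¹ : G) : G ⧸ H), by
    have := QuotientGroup.eq.1 (QuotientGroup.out_eq' ((g⁻¹ : G) : G ⧸ H)).symm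
    simpa using this⟩

theorem mk_inv_subgroup_mul (h : H) (g : G) :
    (((h * g : G)⁻¹ : G) : G ⧸ H) = ((g⁻¹ : G) : G ⧸ H) := by
  rw [mul_inv_rev, QuotientGroup.mk_mul_of_mem _ (inv_mem h.2)]

theorem cosetPart_subgroup_mul (h : H) (g : G) : cosetPart H (h * g) = h * cosetPart H g := by
  refine Subtype.ext ?_
  simp only [cosetPart, mk_inv_subgroup_mul, Subgroup.coe_mul, mul_assoc]

theorem subgroupInclusion_cosetPart_mul (g : G) (c : F) :
    subgroupInclusion F H (MonoidAlgebra.single (cosetPart H g) c) *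
      MonoidAlgebra.single (Quotient.out ((g⁻¹ : G) : G ⧸ H))⁻¹ 1 = MonoidAlgebra.single g c := by
  rw [subgroupInclusion_single, MonoidAlgebra.single_mul_single]
  simp [cosetPart]

variable [Fintype (G ⧸ H)] [DecidableEq (G ⧸ H)]

variable (F) in
/-- The action of `F[G]` on `F[G ⧸ H]`, as a matrix representation. -/
noncomputable def cosetRep : MonoidAlgebra F G →+* Matrix (G ⧸ H) (G ⧸ H) F :=
  (augmentation F G).mapMatrix.comp (permHom F)

theorem cosetRep_single (g : G) (c : F) (i j : G ⧸ H) :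
    cosetRep F H (MonoidAlgebra.single g c) i j = if g • j = i then c else 0 := by
  simp only [cosetRep, RingHom.comp_apply, RingHom.mapMatrix_apply, Matrix.map_apply,
    permHom_single]
  split_ifs
  · rw [augmentation_single]
  · rw [map_zero]

/-- Elements of H fix the trivial coset, so the row at that coset sees F[H] only through the
augmentation. This makes `cosetCoord` semilinear over F[H]. -/
theorem cosetRep_subgroupInclusion (r : MonoidAlgebra F H) :
    cosetRep F H (subgroupInclusion F H r) ((1 : G) : G ⧸ H) =
      Pi.single ((1 : G) : G ⧸ H) (augmentation F H r) := by
  induction r using MonoidAlgebra.induction_linear with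
  | zero => simp; rfl
  | add x y hx hy => 
    rw [map_add, map_add, map_add, Pi.single_add, ← hx, ← hy]
    rfl
  | single h c =>
    ext j
    rw [subgroupInclusion_single, cosetRep_single, augmentation_single, Pi.single_apply]
    congr 1
    rw [← eq_inv_smul_iff, MulAction.Quotient.smul_coe, eq_iff_iff]
    refine Eq.congr_right ?_
    exact QuotientGroup.eq.2 (by simp)

/-- The coordinates on `F ⊗[F[H]] F[G]` with respect to the cosets of `H`. -/
noncomputable def cosetCoord : MonoidAlgebra F G →+ (G ⧸ H → F) :=
  (Pi.evalAddMonoidHom (fun _ : G ⧸ H => G ⧸ H → F) ((1 : G) : G ⧸ H)).comp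
    ((cosetRep F H).toAddMonoidHom : MonoidAlgebra F G →+ (G ⧸ H → G ⧸ H → F))

theorem cosetCoord_apply (a : MonoidAlgebra F G) :
    cosetCoord H a = cosetRep F H a ((1 : G) : G ⧸ H) := rfl

theorem cosetCoord_mul (a x : MonoidAlgebra F G) :
    cosetCoord H (a * x) = Matrix.vecMul (cosetCoord H a) (cosetRep F H x) := by
  rw [cosetCoord_apply, map_mul]
  rfl

theorem cosetCoord_subgroupInclusion_mul (r : MonoidAlgebra F H) (a : MonoidAlgebra F G) :
    cosetCoord H (subgroupInclusion F H r * a) = augmentation F H r • cosetCoord H a := by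
  rw [cosetCoord_mul, cosetCoord_apply, cosetRep_subgroupInclusion, Matrix.single_vecMul]
  rfl

theorem cosetCoord_single (g : G) (c : F) :
    cosetCoord H (MonoidAlgebra.single g c) = Pi.single ((g⁻¹ : G) : G ⧸ H) c := by
  ext j
  rw [cosetCoord_apply, cosetRep_single, Pi.single_apply]
  congr 1
  rw [smul_eq_iff_eq_inv_smul, MulAction.Quotient.smul_coe, smul_eq_mul, mul_one]

variable (F) in
/-- The functor `M ↦ F ⊗[F[H]] M` on left `F[G]`-modules. -/
noncomputable def subgroupCoinvariants : ModuleCat.{u} (MonoidAlgebra F G) ⥤ ModuleCat.{u} F :=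
  ModuleCat.restrictScalars (subgroupInclusion F H) ⋙ baseChangeFunctor (augmentation F H)

instance : (subgroupCoinvariants F H).Additive := by
  unfold subgroupCoinvariants
  infer_instance

/-- Since G/H consists of left cosets while F[G] is a left F[H]-module, the basis consists of the
inverses of the coset representatives, and g has its coordinate at the coset of g⁻¹. -/
theorem exists_subgroupCoinvariants_self_equiv :
    ∃ θ : (subgroupCoinvariants F H).obj (ModuleCat.of _ (MonoidAlgebra F G)) ≃ₗ[F] (G ⧸ H → F),
      ∀ x t, θ (((subgroupCoinvariants F H).map (rightMul x)).hom t) =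
        Matrix.vecMul (θ t) (cosetRep F H x) := by
  let M := (ModuleCat.restrictScalars (subgroupInclusion F H)).obj
    (ModuleCat.of _ (MonoidAlgebra F G))
  let b : M →+ (G ⧸ H → F) := cosetCoord H
  let t : G ⧸ H → M := fun c => (MonoidAlgebra.single (Quotient.out c)⁻¹ 1 : MonoidAlgebra F G)
  have ht (c : G ⧸ H) : b (t c) = Pi.single c 1 := by
    change cosetCoord H (MonoidAlgebra.single _ _) = _
    rw [cosetCoord_single, inv_inv, QuotientGroup.out_eq']
  have hs (s : F) (a : M) :
      (Submodule.Quotient.mk (s ⊗ₜ[ℤ] a) : BaseChange (augmentation F H) M) =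
        ∑ c, Submodule.Quotient.mk ((s * b a c) ⊗ₜ[ℤ] t c) := by
    refine MonoidAlgebra.induction_linear (motive := fun a : MonoidAlgebra F G =>
      (Submodule.Quotient.mk (s ⊗ₜ[ℤ] (show M from a)) : BaseChange (augmentation F H) M) =
        ∑ c, Submodule.Quotient.mk ((s * b (show M from a) c) ⊗ₜ[ℤ] t c)) a ?_ ?_ ?_
    · have h0 : (show M from (0 : MonoidAlgebra F G)) = 0 := rfl
      simp [h0]
    · intro x y hx hy
      have hxy : (show M from (x + y : MonoidAlgebra F G)) = (show M from x) + (show M from y) :=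
        rfl
      rw [hxy, TensorProduct.tmul_add, Submodule.Quotient.mk_add, hx, hy, map_add,
        ← Finset.sum_add_distrib]
      simp only [Pi.add_apply, mul_add, TensorProduct.add_tmul, Submodule.Quotient.mk_add]
    · intro g c
      have hb : b (show M from MonoidAlgebra.single g c) =
        Pi.single ((g⁻¹ : G) : G ⧸ H) c := cosetCoord_single H g c
      have hsmul : (show M from MonoidAlgebra.single g c) =
        (MonoidAlgebra.single (cosetPart H g) c : MonoidAlgebra F H) • t ((g⁻¹ : G) : G ⧸ H) :=
        (subgroupInclusion_cosetPart_mul H g c).symm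
      rw [Finset.sum_eq_single ((g⁻¹ : G) : G ⧸ H)]
      · rw [hb, Pi.single_eq_same, hsmul, ← baseChange_mk_mul_tmul, augmentation_single]
      · intro j _ hj
        rw [hb, Pi.single_eq_of_ne hj, mul_zero, TensorProduct.zero_tmul,
          Submodule.Quotient.mk_zero]
      · simp
  exact ⟨baseChangeCoordEquiv (augmentation F H) b t (cosetCoord_subgroupInclusion_mul H) ht hs,
    fun x => baseChangeCoordEquiv_map (augmentation F H) b t _ ht hs
      ((ModuleCat.restrictScalars (subgroupInclusion F H)).map (rightMul x)).hom _
      fun a => cosetCoord_mul H a x⟩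

end Subgroup

section RestrictScalars

variable {R S : Type u} [Ring R] [Ring S] (f : R →+* S)

instance restrictScalars_preservesHomology :
    (ModuleCat.restrictScalars.{u} f).PreservesHomology :=
  Functor.preservesHomology_of_map_exact _ fun S hS => by
    rw [ShortComplex.ShortExact.moduleCat_exact_iff_function_exact] at hS ⊢
    exact hS

/-- The right adjoint, coextension Hom_R(S, –), preserves surjections when S is projective over R.
With R = F[H] and S = F[G], a projective resolution over F[G] restricts to one over F[H]. -/
theorem restrictScalars_preservesProjectiveObjects
    (hf : Module.Projective R ((ModuleCat.restrictScalars f).obj (ModuleCat.of S S))) :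
    (ModuleCat.restrictScalars.{u} f).PreservesProjectiveObjects := by
  have : (ModuleCat.coextendScalars.{u} f).PreservesEpimorphisms := ⟨fun {M N} g hg => by
    rw [ModuleCat.epi_iff_surjective] at hg ⊢
    intro (y : (ModuleCat.restrictScalars f).obj (ModuleCat.of S S) →ₗ[R] N)
    exact Module.projective_lifting_property g.hom y hg⟩
  exact Functor.preservesProjectiveObjects_of_adjunction_of_preservesEpimorphisms
    (ModuleCat.restrictCoextendScalarsAdj f)

end RestrictScalars

section SubgroupProjective

variable {F G : Type u} [DivisionRing F] [Group G] (H : Subgroup G)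

/-- The coordinates of the left `F[H]`-module `F[G]` with respect to coset representatives. -/
noncomputable def freeSubgroupCoord : MonoidAlgebra F G →+ ((G ⧸ H) →₀ MonoidAlgebra F H) :=
  (Finsupp.liftAddHom fun g : G =>
    (Finsupp.singleAddHom ((g⁻¹ : G) : G ⧸ H)).comp
      (MonoidAlgebra.singleAddHom (R := F) (cosetPart H g))).comp
    (MonoidAlgebra.coeffAddEquiv (R := F) (M := G)).toAddMonoidHom

theorem freeSubgroupCoord_single (g : G) (c : F) :
    freeSubgroupCoord H (MonoidAlgebra.single g c) =
      Finsupp.single ((g⁻¹ : G) : G ⧸ H) (MonoidAlgebra.single (cosetPart H g) c) := by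
  have : freeSubgroupCoord H (MonoidAlgebra.single g c) =
    Finsupp.sum (Finsupp.single g c) fun g c => Finsupp.single ((g⁻¹ : G) : G ⧸ H)
      (MonoidAlgebra.single (cosetPart H g) c) := rfl
  rw [this, Finsupp.sum_single_index (by simp)]

theorem freeSubgroupCoord_subgroupInclusion_mul (r : MonoidAlgebra F H) (a : MonoidAlgebra F G) :
    freeSubgroupCoord H (subgroupInclusion F H r * a) = r • freeSubgroupCoord H a := by
  induction r using MonoidAlgebra.induction_linear with
  | zero => simp
  | add x y hx hy => rw [map_add, add_mul, map_add, hx, hy, add_smul]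
  | single h d =>
    induction a using MonoidAlgebra.induction_linear with
    | zero => simp
    | add x y hx hy => rw [mul_add, map_add, hx, hy, map_add, smul_add]
    | single g c =>
      rw [subgroupInclusion_single, MonoidAlgebra.single_mul_single, freeSubgroupCoord_single,
        freeSubgroupCoord_single, Finsupp.smul_single, smul_eq_mul,
        MonoidAlgebra.single_mul_single, mk_inv_subgroup_mul, cosetPart_subgroup_mul]

theorem projective_restrictScalars_subgroupInclusion : Module.Projective (MonoidAlgebra F H)
    ((ModuleCat.restrictScalars (subgroupInclusion F H)).obj
      (ModuleCat.of _ (MonoidAlgebra F G))) := by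
  let M := (ModuleCat.restrictScalars (subgroupInclusion F H)).obj
    (ModuleCat.of _ (MonoidAlgebra F G))
  let i : M →ₗ[MonoidAlgebra F H] ((G ⧸ H) →₀ MonoidAlgebra F H) :=
    { toFun := freeSubgroupCoord H
      map_add' := map_add (freeSubgroupCoord (F := F) H)
      map_smul' := freeSubgroupCoord_subgroupInclusion_mul H }
  let t : G ⧸ H → M := fun c => (MonoidAlgebra.single (Quotient.out c)⁻¹ 1 : MonoidAlgebra F G)
  refine Module.Projective.of_split i (Finsupp.linearCombination _ t) ?_
  refine LinearMap.toAddMonoidHom_injective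
    (MonoidAlgebra.addMonoidHom_ext (R := F) (M := G) (N := M) fun g c => ?_)
  have h1 : i (show M from MonoidAlgebra.single g c) =
    Finsupp.single ((g⁻¹ : G) : G ⧸ H) (MonoidAlgebra.single (cosetPart H g) c) :=
    freeSubgroupCoord_single H g c
  have h2 : Finsupp.linearCombination _ t (i (show M from MonoidAlgebra.single g c)) =
      (show M from MonoidAlgebra.single g c) := by
    rw [h1, Finsupp.linearCombination_single]
    exact subgroupInclusion_cosetPart_mul H g c
  exact h2

end SubgroupProjective

/-! ### Comparison of Betti numbers -/

section Betti

variable {F G D : Type u} [DivisionRing F] [Group G] [DivisionRing D]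

theorem functorRank_subgroupCoinvariants_le (H : Subgroup G) [Fintype (G ⧸ H)]
    (hG : IsLocallyIndicable G) {ι : MonoidAlgebra F G →+* D} (hD : IsHughesFree ι)
    (hU : IsUniversalDivisionRing ι) (m n : ℕ)
    (f : ModuleCat.of (MonoidAlgebra F G) (Fin m → MonoidAlgebra F G) ⟶
      ModuleCat.of (MonoidAlgebra F G) (Fin n → MonoidAlgebra F G)) :
    functorRank (subgroupCoinvariants F H) f ≤
      Fintype.card (G ⧸ H) * functorRank (baseChangeFunctor ι) f := by
  classical
  obtain ⟨θ, hθ⟩ := exists_baseChangeFunctor_self_equiv ι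
  obtain ⟨θ', hθ'⟩ := exists_subgroupCoinvariants_self_equiv (F := F) H
  rw [functorRank_free hθ, functorRank_free hθ']
  refine (rowRank_permHom_augmentation_le (κ := G ⧸ H) hG hD hU (freeMatrix f)).trans_eq ?_
  -- The functor of ι has 1 × 1 blocks; reindexing removes the factor `Unit`.
  exact congrArg _ (rowRank_reindex (Equiv.prodUnique (Fin m) Unit) (Equiv.prodUnique (Fin n) Unit)
    ((freeMatrix f).map ι)).symm

variable (F) in
/-- The trivial module of `F[G]` restricts to the trivial module of `F[H]`. -/
noncomputable def restrictTrivialModuleIso (H : Subgroup G) :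
    trivialModule F H ≅ (ModuleCat.restrictScalars (subgroupInclusion F H)).obj
      (trivialModule F G) :=
  (ModuleCat.restrictScalarsComp' _ _ _ (augmentation_comp_subgroupInclusion H).symm).app _

/-- The homology of `H` with trivial coefficients, computed from a resolution over `F[G]`. -/
noncomputable def groupHomologySubgroupIso (H : Subgroup G)
    (P : ProjectiveResolution (trivialModule F G)) (m : ℕ) :
    groupHomologyOver (augmentation F H) m ≅
      (((subgroupCoinvariants F H).mapHomologicalComplex _).obj P.complex).homology m :=
  haveI := restrictScalars_preservesProjectiveObjects _
    (projective_restrictScalars_subgroupInclusion (F := F) H)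
  ((baseChangeFunctor (augmentation F H)).leftDerived m).mapIso (restrictTrivialModuleIso F H) ≪≫
    ((ModuleCat.restrictScalars (subgroupInclusion F H)).mapProjectiveResolution
      P).isoLeftDerivedObj (baseChangeFunctor (augmentation F H)) m

theorem bettiOver_eq_finrank {φ : MonoidAlgebra F G →+* D} {m : ℕ} {V : ModuleCat.{u} D}
    (e : groupHomologyOver φ m ≅ V) [Module.Finite D V] :
    bettiOver φ m = Module.finrank D V := by
  rw [bettiOver, e.toLinearEquiv.rank_eq, ← Module.finrank_eq_rank, Cardinal.toENat_nat]

theorem finrank_homology_le {R E E' : Type u} [Ring R] [DivisionRing E] [DivisionRing E']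
    {T : ModuleCat.{u} R ⥤ ModuleCat.{u} E} {T' : ModuleCat.{u} R ⥤ ModuleCat.{u} E'}
    [T.Additive] [T'.Additive] {κ : Type*} [Fintype κ] [DecidableEq κ]
    (θ : T.obj (ModuleCat.of R R) ≃ₗ[E] (Unit → E))
    (θ' : T'.obj (ModuleCat.of R R) ≃ₗ[E'] (κ → E'))
    (h : ∀ (m n : ℕ) (f : ModuleCat.of R (Fin m → R) ⟶ ModuleCat.of R (Fin n → R)),
      functorRank T' f ≤ Fintype.card κ * functorRank T f)
    (S : ShortComplex (ModuleCat.{u} R)) [Module.Finite R S.X₁] [Module.Finite R S.X₂]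
    [Module.Finite R S.X₃] [Projective S.X₁] [Projective S.X₂] [Projective S.X₃] :
    Module.Finite E (S.map T).homology ∧ Module.Finite E' (S.map T').homology ∧
      Fintype.card κ * Module.finrank E (S.map T).homology ≤
        Module.finrank E' (S.map T').homology := by
  have : Module.Finite E (S.map T).X₂ := finite_functor_obj θ S.X₂
  have : Module.Finite E' (S.map T').X₂ := finite_functor_obj θ' S.X₂
  obtain ⟨h1, h2⟩ := finrank_homology_shortComplex (S.map T)
  obtain ⟨h1', h2'⟩ := finrank_homology_shortComplex (S.map T')
  refine ⟨h1, h1', ?_⟩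
  have hf := functorRank_le_of_free h S.f
  have hg := functorRank_le_of_free h S.g
  have hX := finrank_functor_obj_eq θ θ' h S.X₂
  change _ = Module.finrank E (T.obj S.X₂) at h2
  change _ = Module.finrank E' (T'.obj S.X₂) at h2'
  change _ + functorRank T S.f + functorRank T S.g = _ at h2
  change _ + functorRank T' S.f + functorRank T' S.g = _ at h2'
  rw [← h2, mul_add, mul_add] at hX
  omega

theorem bettiOver_le_betti_div_index {n : ℕ} (hG : IsLocallyIndicable G)
    (hFP : IsTypeFP F G (n + 1)) {ι : MonoidAlgebra F G →+* D} (hD : IsHughesFree ι)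
    (hU : IsUniversalDivisionRing ι) (H : Subgroup G) [H.FiniteIndex] {m : ℕ} (hm : m ≤ n) :
    betti F H m ≠ ⊤ ∧
      (bettiOver ι m : ℝ≥0∞) ≤ (betti F H m : ℝ≥0∞) / (H.index : ℝ≥0∞) := by
  classical
  obtain ⟨P, hP⟩ := hFP
  let : Fintype (G ⧸ H) := H.fintypeQuotientOfFiniteIndex
  obtain ⟨θ, -⟩ := exists_baseChangeFunctor_self_equiv ι
  obtain ⟨θ', -⟩ := exists_subgroupCoinvariants_self_equiv (F := F) H
  -- In degree 0 `next` takes the default value 0, so X₃ is P₀ there, which is still finitely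
  -- generated. The degree n + 1 in the finiteness hypothesis is needed for X₁.
  have hnext : (ComplexShape.down ℕ).next m ≤ n + 1 := by
    rcases m with _ | m
    · simp
    · simp; omega
  have : Module.Finite (MonoidAlgebra F G) (P.complex.sc m).X₁ := hP _ (by simp; omega)
  have : Module.Finite (MonoidAlgebra F G) (P.complex.sc m).X₂ := hP _ (by omega)
  have : Module.Finite (MonoidAlgebra F G) (P.complex.sc m).X₃ := hP _ hnext
  have : Projective (P.complex.sc m).X₁ := P.projective _
  have : Projective (P.complex.sc m).X₂ := P.projective _
  have : Projective (P.complex.sc m).X₃ := P.projective _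
  obtain ⟨h1, h2, h3⟩ := finrank_homology_le θ θ'
    (functorRank_subgroupCoinvariants_le H hG hD hU) (P.complex.sc m)
  rw [betti, bettiOver_eq_finrank (V := ((P.complex.sc m).map (subgroupCoinvariants F H)).homology)
    (groupHomologySubgroupIso H P m),
    bettiOver_eq_finrank (V := ((P.complex.sc m).map (baseChangeFunctor ι)).homology)
    (P.isoLeftDerivedObj (baseChangeFunctor ι) m)]
  refine ⟨ENat.natCast_ne_top _, ?_⟩
  rw [ENNReal.le_div_iff_mul_le (Or.inl (by simp [Subgroup.FiniteIndex.index_ne_zero]))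
    (Or.inl (by simp)), mul_comm, Subgroup.index, Nat.card_eq_fintype_card]
  exact_mod_cast h3

end Betti

theorem theoremC {F G D : Type u} [DivisionRing F] [Group G] [DivisionRing D] (n : ℕ)
    (hG : IsLocallyIndicable G) (hFP : IsTypeFP F G (n + 1))
    (ι : MonoidAlgebra F G →+* D) (hD : IsHughesFree ι) (hU : IsUniversalDivisionRing ι) :
    (∀ H : Subgroup G, H.FiniteIndex → ∀ m ≤ n,
      betti F H m ≠ ⊤ ∧
      (bettiOver ι m : ℝ≥0∞) ≤ (betti F H m : ℝ≥0∞) / (H.index : ℝ≥0∞)) ∧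
    (∀ K : ℕ → Subgroup G, IsResidualChain K → ∀ m ≤ n,
      (bettiOver ι m : ℝ≥0∞) ≤ homologyGradient F K m) := by
  have key : ∀ H : Subgroup G, H.FiniteIndex → ∀ m ≤ n, betti F H m ≠ ⊤ ∧
      (bettiOver ι m : ℝ≥0∞) ≤ (betti F H m : ℝ≥0∞) / (H.index : ℝ≥0∞) :=
    fun H _ m hm => bettiOver_le_betti_div_index hG hFP hD hU H hm
  exact ⟨key, fun K hK m hm => Filter.le_limsup_of_frequently_le
    (Filter.Frequently.of_forall fun i => (key (K i) (hK.finiteIndex i) m hm).2)⟩
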